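/- Let $\Omega\subset\mathbb R^d$ be a bounded open set, $T>0$, $Q=\Omega\times(0,T)$, and let $\|\cdot\|$ be the norm of $L^2(Q)$. Let $\sigma,\nu$ be measurable functions on $\Omega$ with $0<\underline\sigma\le\sigma\le\overline\sigma$ and $0<\underline\nu\le\nu\le\overline\nu$ almost everywhere, and set $\underline{\mu_1}=\tfrac1{\sqrt2}\min\{\underline\nu,\underline\sigma\}$. Let $\lambda>0$, $y_d\in L^2(Q)$, and let $C_F>0$ be a constant in Friedrichs' inequality, $\|w\|_{L^2(\Omega)}\le C_F\|\nabla w\|_{L^2(\Omega)}$ for all $w\in H^1_0(\Omega)$. With $\omega=2\pi/T$ and the Fourier coefficients $y_k^c(x)=\frac2T\int_0^T y(x,t)\cos(k\omega t)\,dt$, $y_k^s(x)=\frac2T\int_0^T y(x,t)\sin(k\omega t)\,dt$, write $\boldsymbol y_k=(y^c_k,y^s_k)$, $\boldsymbol y_k^\perp=(-y^s_k,y^c_k)$, $$\|\partial_t^{1/2}y\|^2=\frac T2\sum_{k\ge1}k\omega\|\boldsymbol y_k\|^2_{L^2(\Omega)},\qquad |y|_{1,\frac12}^2=\|\nabla y\|^2+\|\partial_t^{1/2}y\|^2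 ,$$ where $\nabla$ is the gradient in $x$. Let $H^{1,0}_0(Q)$ be the space of functions in $L^2(Q)$ with weak spatial gradient in $L^2(Q)^d$ that vanish on $\partial\Omega\times(0,T)$ (the closure of the smooth functions vanishing near $\partial\Omega\times(0,T)$), and $H^{1,\frac12}_{0,per}(Q)=\{y\in H^{1,0}_0(Q):\|\partial_t^{1/2}y\|<\infty\}$. For $v\in L^2(Q)$ the state $y(v)\in H^{1,\frac12}_{0,per}(Q)$ is the weak solution of $\sigma\partial_t y-\nabla\cdot(\nu\nabla y)=v$ in $Q$, $y=0$ on $\partial\Omega\times(0,T)$, $y(0)=y(T)$, that is, $$\int_Q\nu\nabla y\cdot\nabla q\,dx\,dt+\frac T2\sum_{k\ge1}k\omega\int_\Omega\sigma\,\boldsymbol y_k\cdot\boldsymbol q_k^\perp\,dx=\int_Q v\,q\,dx\,dt\qquad\forall q\in H^{1,\frac12}_{0,per}(Q).$$ Let $\mathcal J(y,u)=\frac12\|y-y_d\|^2+\frac\lambda2\|u\|^2$ and let $u\in L^2(Q)$ be the optimal control, i.e. $\mathcal J(y(u),u)\le\mathcal J(y(w),w)$ for all $w\in L^2(Q)$.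 **Theorem.** For every control $v\in L^2(Q)$, every $\eta\in H^{1,0}_0(Q)$ with $\partial_t\eta\in L^2(Q)$ and $\eta(0)=\eta(T)$, and every $\boldsymbol\tau\in L^2(Q)^d$ with $\nabla\cdot\boldsymbol\tau(\cdot,t)\in L^2(\Omega)$ for a.e. $t\in(0,T)$, $$|||u-v|||_1^2\le\mathcal J(y(v),v)-\mathcal J(y(u),u)+\frac{3\lambda}{4C_F^2}\bigl(C_F\|\mathcal R_1(\eta,\boldsymbol\tau,v)\|+\|\mathcal R_2(\eta,\boldsymbol\tau)\|\bigr)^2,$$ where $\mathcal R_1(\eta,\boldsymbol\tau,v)=\sigma\partial_t\eta-\nabla\cdot\boldsymbol\tau-v$, $\mathcal R_2(\eta,\boldsymbol\tau)=\boldsymbol\tau-\nu\nabla\eta$ and $$|||u-v|||_1^2=\tfrac12\|y(u)-y(v)\|^2+\frac{\lambda\,\underline{\mu_1}^2}{2C_F^2}\,|y(u)-y(v)|_{1,\frac12}^2 .$$ (The right-hand side is $+\infty$ if $\mathcal R_1(\eta,\boldsymbol\tau,v)\notin L^2(Q)$.) -/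

import Mathlib

open MeasureTheory Set Filter Topology
open scoped ENNReal ContDiff

noncomputable section

/-- The Euclidean space `ℝ^d`. -/
abbrev Sp (d : ℕ) : Type := EuclideanSpace ℝ (Fin d)

variable {d : ℕ}

/-- The measure of the space-time cylinder `Q = Ω × (0,T)`. -/
def volQ (Ω : Set (Sp d)) (T : ℝ) : Measure (Sp d × ℝ) :=
  volume.restrict (Ω ×ˢ Ioo 0 T)

/-- The classical gradient of `φ(x,t)` with respect to `x`. -/
def spaceGrad (φ : Sp d × ℝ → ℝ) (z : Sp d × ℝ) : Sp d :=
  gradient (fun x => φ (x, z.2)) z.1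

/-- The classical derivative of `φ(x,t)` with respect to `t`. -/
def timeDeriv (φ : Sp d × ℝ → ℝ) (z : Sp d × ℝ) : ℝ :=
  deriv (fun t => φ (z.1, t)) z.2

/-! ### Function spaces

Elements of first order Sobolev spaces are handled as pairs of a function and its weak
derivative; both are determined up to null sets. -/

/-- `w ∈ H^1_0(Ω)` with weak gradient `g`: the closure of `C_c^∞(Ω)` in `H^1(Ω)`. -/
def IsH1Zero (Ω : Set (Sp d)) (w : Sp d → ℝ) (g : Sp d → Sp d) : Prop :=
  MemLp w 2 (volume.restrict Ω) ∧ MemLp g 2 (volume.restrict Ω) ∧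
    ∃ φ : ℕ → Sp d → ℝ,
      (∀ n, ContDiff ℝ ∞ (φ n) ∧ HasCompactSupport (φ n) ∧ tsupport (φ n) ⊆ Ω) ∧
      Tendsto (fun n => eLpNorm (fun x => φ n x - w x) 2 (volume.restrict Ω)) atTop (𝓝 0) ∧
      Tendsto (fun n => eLpNorm (fun x => gradient (φ n) x - g x) 2 (volume.restrict Ω))
        atTop (𝓝 0)

/-- `C` is an admissible constant in Friedrichs' inequality `‖w‖ ≤ C ‖∇w‖` on `H^1_0(Ω)`. -/
def IsFriedrichsConst (Ω : Set (Sp d)) (C : ℝ) : Prop :=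
  0 < C ∧ ∀ (w : Sp d → ℝ) (g : Sp d → Sp d), IsH1Zero Ω w g →
    ∫ x in Ω, w x ^ 2 ≤ C ^ 2 * ∫ x in Ω, ‖g x‖ ^ 2

/-- `y ∈ H^{1,0}_0(Q)` with weak spatial gradient `G`: the closure, in the norm
`(‖y‖² + ‖∇y‖²)^{1/2}` of `H^{1,0}(Q)`, of the smooth functions that vanish near the lateral
surface `∂Ω × (0,T)`. -/
def IsH10Zero (Ω : Set (Sp d)) (T : ℝ) (y : Sp d × ℝ → ℝ) (G : Sp d × ℝ → Sp d) : Prop :=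
  MemLp y 2 (volQ Ω T) ∧ MemLp G 2 (volQ Ω T) ∧
    ∃ φ : ℕ → Sp d × ℝ → ℝ,
      (∀ n, ContDiff ℝ ∞ (φ n) ∧
        ∃ K : Set (Sp d), IsCompact K ∧ K ⊆ Ω ∧ ∀ x t, x ∉ K → φ n (x, t) = 0) ∧
      Tendsto (fun n => eLpNorm (fun z => φ n z - y z) 2 (volQ Ω T)) atTop (𝓝 0) ∧
      Tendsto (fun n => eLpNorm (fun z => spaceGrad (φ n) z - G z) 2 (volQ Ω T)) atTop (𝓝 0)

/-- `dy ∈ L²(Q)` is the weak time derivative of `y ∈ L²(Q)`. -/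
def IsWeakTimeDeriv (Ω : Set (Sp d)) (T : ℝ) (y dy : Sp d × ℝ → ℝ) : Prop :=
  MemLp y 2 (volQ Ω T) ∧ MemLp dy 2 (volQ Ω T) ∧
    ∀ φ : Sp d × ℝ → ℝ, ContDiff ℝ ∞ φ → HasCompactSupport φ →
      tsupport φ ⊆ Ω ×ˢ Ioo 0 T →
      ∫ z, y z * timeDeriv φ z ∂(volQ Ω T) = -∫ z, dy z * φ z ∂(volQ Ω T)

/-- `y(0) = y(T)`, for functions with a representative that is continuous in time
(every function with a weak time derivative in `L²(Q)` has one, unique up to null sets of `x`). -/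
def IsTimePeriodic (Ω : Set (Sp d)) (T : ℝ) (y : Sp d × ℝ → ℝ) : Prop :=
  ∃ y' : Sp d × ℝ → ℝ, y' =ᵐ[volQ Ω T] y ∧
    ∀ᵐ x ∂(volume.restrict Ω),
      ContinuousOn (fun t => y' (x, t)) (Icc 0 T) ∧ y' (x, 0) = y' (x, T)

/-- `η ∈ H^{1,1}_{0,per}(Q)` with weak spatial gradient `G` and weak time derivative `dη`. -/
def IsH11ZeroPer (Ω : Set (Sp d)) (T : ℝ) (η : Sp d × ℝ → ℝ) (G : Sp d × ℝ → Sp d)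
    (dη : Sp d × ℝ → ℝ) : Prop :=
  IsH10Zero Ω T η G ∧ IsWeakTimeDeriv Ω T η dη ∧ IsTimePeriodic Ω T η

/-- `τ ∈ H(div,Q)` with weak spatial divergence `D`: `τ ∈ L²(Q)^d`, and for almost every `t` the
divergence of `τ(·,t)` is `D(·,t) ∈ L²(Ω)`. -/
def IsHDiv (Ω : Set (Sp d)) (T : ℝ) (τ : Sp d × ℝ → Sp d) (D : Sp d × ℝ → ℝ) : Prop :=
  MemLp τ 2 (volQ Ω T) ∧ AEStronglyMeasurable D (volQ Ω T) ∧
    ∀ᵐ t ∂(volume.restrict (Ioo (0 : ℝ) T)),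
      MemLp (fun x => D (x, t)) 2 (volume.restrict Ω) ∧
      ∀ (w : Sp d → ℝ) (g : Sp d → Sp d), IsH1Zero Ω w g →
        ∫ x in Ω, D (x, t) * w x = -∫ x in Ω, inner ℝ (τ (x, t)) (g x)

/-! ### Fourier series in time -/

/-- The angular frequency `ω = 2π/T`. -/
def freq (T : ℝ) : ℝ := 2 * Real.pi / T

/-- The cosine coefficient `y_k^c`, `k ≥ 1`. -/
def cosCoeff (T : ℝ) (y : Sp d × ℝ → ℝ) (k : ℕ) (x : Sp d) : ℝ :=
  2 / T * ∫ t in (0 : ℝ)..T, y (x, t) * Real.cos (k * freq T * t)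

/-- The sine coefficient `y_k^s`, `k ≥ 1`. -/
def sinCoeff (T : ℝ) (y : Sp d × ℝ → ℝ) (k : ℕ) (x : Sp d) : ℝ :=
  2 / T * ∫ t in (0 : ℝ)..T, y (x, t) * Real.sin (k * freq T * t)

/-- The terms `k ω ‖(y_k^c, y_k^s)‖²_Ω` of the series for `‖∂_t^{1/2} y‖²`
(the term with `k = 0` vanishes). -/
def halfTerm (Ω : Set (Sp d)) (T : ℝ) (y : Sp d × ℝ → ℝ) (k : ℕ) : ℝ :=
  k * freq T * ∫ x in Ω, (cosCoeff T y k x ^ 2 + sinCoeff T y k x ^ 2)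

/-- `‖∂_t^{1/2} y‖² = (T/2) ∑_{k ≥ 1} k ω ‖(y_k^c, y_k^s)‖²_Ω`. -/
def halfNormSq (Ω : Set (Sp d)) (T : ℝ) (y : Sp d × ℝ → ℝ) : ℝ :=
  T / 2 * ∑' k : ℕ, halfTerm Ω T y k

/-- The form `∫_Q σ ∂_t^{1/2} y ∂_t^{1/2} q^⊥`, that is
`(T/2) ∑_{k ≥ 1} k ω ⟨σ y_k, q_k^⊥⟩_Ω` with `y_k = (y_k^c, y_k^s)` and
`q_k^⊥ = (-q_k^s, q_k^c)`. It equals `∫_Q σ (∂_t y) q` if `y` is time-periodic with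
`∂_t y ∈ L²(Q)`. -/
def halfForm (Ω : Set (Sp d)) (T : ℝ) (σ : Sp d → ℝ) (y q : Sp d × ℝ → ℝ) : ℝ :=
  T / 2 * ∑' k : ℕ, k * freq T *
    ∫ x in Ω, σ x *
      (cosCoeff T y k x * (-sinCoeff T q k x) + sinCoeff T y k x * cosCoeff T q k x)

/-- `y ∈ H^{1,1/2}_{0,per}(Q)` with weak spatial gradient `G`. -/
def IsH1HalfZeroPer (Ω : Set (Sp d)) (T : ℝ) (y : Sp d × ℝ → ℝ) (G : Sp d × ℝ → Sp d) : Prop :=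
  IsH10Zero Ω T y G ∧ Summable (halfTerm Ω T y)

/-- The squared seminorm `|y|²_{1,1/2} = ‖∇y‖² + ‖∂_t^{1/2} y‖²`. -/
def seminormSq (Ω : Set (Sp d)) (T : ℝ) (y : Sp d × ℝ → ℝ) (G : Sp d × ℝ → Sp d) : ℝ :=
  ∫ z, ‖G z‖ ^ 2 ∂(volQ Ω T) + halfNormSq Ω T y

/-! ### The optimal control problem -/

/-- `y`, with weak spatial gradient `G`, is the state `y(v)` of the control `v`: the weak solution
in `H^{1,1/2}_{0,per}(Q)` of `σ ∂_t y - ∇ · (ν ∇y) = v` in `Q`, `y = 0` on `∂Ω × (0,T)`,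
`y(0) = y(T)`. -/
def IsState (Ω : Set (Sp d)) (T : ℝ) (σ ν : Sp d → ℝ) (v : Sp d × ℝ → ℝ)
    (y : Sp d × ℝ → ℝ) (G : Sp d × ℝ → Sp d) : Prop :=
  IsH1HalfZeroPer Ω T y G ∧
    ∀ (q : Sp d × ℝ → ℝ) (Gq : Sp d × ℝ → Sp d), IsH1HalfZeroPer Ω T q Gq →
      ∫ z, ν z.1 * inner ℝ (G z) (Gq z) ∂(volQ Ω T) + halfForm Ω T σ y q
        = ∫ z, v z * q z ∂(volQ Ω T)

/-- The cost functional `J(y,u) = ½ ‖y - y_d‖² + (lam/2) ‖u‖²`. -/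
def cost (Ω : Set (Sp d)) (T lam : ℝ) (yd y u : Sp d × ℝ → ℝ) : ℝ :=
  1 / 2 * ∫ z, (y z - yd z) ^ 2 ∂(volQ Ω T) + lam / 2 * ∫ z, u z ^ 2 ∂(volQ Ω T)

/-- `u ∈ L²(Q)` is an optimal control, with state `y(u) = yu` (weak spatial gradient `Gu`). -/
def IsOptimal (Ω : Set (Sp d)) (T : ℝ) (σ ν : Sp d → ℝ) (lam : ℝ) (yd : Sp d × ℝ → ℝ)
    (u yu : Sp d × ℝ → ℝ) (Gu : Sp d × ℝ → Sp d) : Prop :=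
  MemLp u 2 (volQ Ω T) ∧ IsState Ω T σ ν u yu Gu ∧
    ∀ (w yw : Sp d × ℝ → ℝ) (Gw : Sp d × ℝ → Sp d), MemLp w 2 (volQ Ω T) →
      IsState Ω T σ ν w yw Gw → cost Ω T lam yd yu u ≤ cost Ω T lam yd yw w

/-- The residual `R₁(η,τ,v) = σ ∂_t η - ∇ · τ - v`. -/
def residual₁ (σ : Sp d → ℝ) (dη divτ v : Sp d × ℝ → ℝ) (z : Sp d × ℝ) : ℝ :=
  σ z.1 * dη z - divτ z - v z

/-- The residual `R₂(η,τ) = τ - ν ∇η`. -/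
def residual₂ (ν : Sp d → ℝ) (Gη τ : Sp d × ℝ → Sp d) (z : Sp d × ℝ) : Sp d :=
  τ z - ν z.1 • Gη z

/-- The constant `μ₁ = min {ν_low, σ_low} / √2`. -/
def muOne (νlow σlow : ℝ) : ℝ := 1 / Real.sqrt 2 * min νlow σlow

/-- The squared error norm
`|||u - v|||₁² = ½ ‖y(u) - y(v)‖² + (lam μ₁² / (2 C_F²)) |y(u) - y(v)|²_{1,1/2}`. -/
def errorNormSq (Ω : Set (Sp d)) (T lam μ₁ CF : ℝ) (yu yv : Sp d × ℝ → ℝ)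
    (Gu Gv : Sp d × ℝ → Sp d) : ℝ :=
  1 / 2 * ∫ z, (yu z - yv z) ^ 2 ∂(volQ Ω T) +
    lam * μ₁ ^ 2 / (2 * CF ^ 2) *
      seminormSq Ω T (fun z => yu z - yv z) (fun z => Gu z - Gv z)

end

/-! ### Square integrable functions on products -/

section ProductMeasure

variable {X Y E : Type*} [MeasurableSpace X] [MeasurableSpace Y] {μ : Measure X} {ν : Measure Y}
  [NormedAddCommGroup E]

/-! The state depends linearly on the control, so along the line through `u` and `v` the cost is a
quadratic polynomial. Optimality at `u` removes its linear term, and the gap J(y(v),v) - J(y(u),u)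
equals ½‖y(u)-y(v)‖² + (λ/2)‖u-v‖² exactly (`IsOptimal.cost_sub_eq`). The first summand is already
that of the error norm. The second dominates the seminorm term by the stability estimate
μ₁|y|_{1,1/2} ≤ C_F‖w‖ for a state y with control w (`IsState.seminormSq_le`), applied to the
difference of the two states. The residual majorant enters only through its sign.

For stability, let p be a partial Fourier sum of y in time with each mode replaced by its conjugate,
(y^c, y^s) ↦ (y^s, -y^c). Testing with y kills the half-order form and leaves ∫ν|∇y|². Testing with
p kills the diffusion term, because ν does not depend on t and conjugate modes are orthogonal in
time, and leaves the partial sum of the half-order norm weighted by σ. Adding the two identities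
controls the whole seminorm by ∫w(y+p). Young's inequality, Friedrichs' inequality for y+p and
‖∇(y+p)‖² ≤ 2‖∇y‖² (orthogonality and Bessel) close the estimate, and the partial sums then exhaust
the series.

The technical point is that p is an admissible test function with gradient the conjugate sum of ∇y.
A finite sum has only finitely many time modes, so only membership in H^{1,0}_0(Q) is at stake; it
is inherited from the approximating smooth functions (`IsH10Zero.modulate`). -/

theorem eLpNorm_two_sq {f : X → E} : eLpNorm f 2 μ ^ 2 = ∫⁻ x, ‖f x‖ₑ ^ 2 ∂μ := by
  have h := eLpNorm_nnreal_pow_eq_lintegral (f := f) (μ := μ) (p := 2) two_ne_zero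
  simpa using h

theorem MeasureTheory.MemLp.ofReal_integral_norm_sq {f : X → E} (hf : MemLp f 2 μ) :
    ENNReal.ofReal (∫ x, ‖f x‖ ^ 2 ∂μ) = eLpNorm f 2 μ ^ 2 := by
  rw [eLpNorm_two_sq, ofReal_integral_eq_lintegral_ofReal
    ((memLp_two_iff_integrable_sq_norm hf.1).1 hf) (ae_of_all _ fun _ => by positivity)]
  refine lintegral_congr fun x => ?_
  rw [ENNReal.ofReal_pow (norm_nonneg _), ofReal_norm]

theorem MeasureTheory.MemLp.ae_slice [SFinite μ] [SFinite ν] {f : X × Y → E}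
    (hf : MemLp f 2 (μ.prod ν)) : ∀ᵐ x ∂μ, MemLp (fun y => f (x, y)) 2 ν := by
  have h := (memLp_two_iff_integrable_sq_norm hf.1).1 hf
  filter_upwards [h.prod_right_ae, hf.1.prodMk_left] with x hx hm
  exact (memLp_two_iff_integrable_sq_norm hm).2 hx

theorem memLp_two_bdd_smul [NormedSpace ℝ E] {a : X → ℝ} {f : X → E}
    (ha : AEStronglyMeasurable a μ) {C : ℝ} (hC : ∀ᵐ x ∂μ, ‖a x‖ ≤ C) (hf : MemLp f 2 μ) :
    MemLp (fun x => a x • f x) 2 μ := by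
  refine hf.of_le_mul (c := C) (ha.smul hf.1) ?_
  filter_upwards [hC] with x hx
  rw [norm_smul]
  gcongr

theorem MeasureTheory.MemLp.integrable_inner {V : Type*} [NormedAddCommGroup V]
    [InnerProductSpace ℝ V] {f g : X → V} (hf : MemLp f 2 μ) (hg : MemLp g 2 μ) :
    Integrable (fun x => inner ℝ (f x) (g x)) μ := by
  refine (((memLp_two_iff_integrable_sq_norm hf.1).1 hf).add
    ((memLp_two_iff_integrable_sq_norm hg.1).1 hg)).mono' (hf.1.inner hg.1)
    (ae_of_all _ fun x => ?_)
  have h := norm_inner_le_norm (𝕜 := ℝ) (f x) (g x)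
  simp only [Pi.add_apply]
  nlinarith [sq_nonneg (‖f x‖ - ‖g x‖), sq_nonneg (‖f x‖ + ‖g x‖)]

variable [NormedSpace ℝ E]

/-- A weighted integral of a function of two variables over the second one. -/
noncomputable def weightedIntegral (ν : Measure Y) (a : Y → ℝ) (f : X × Y → E) (x : X) : E :=
  ∫ y, a y • f (x, y) ∂ν

/-- Cauchy-Schwarz: drop the weight, then compare the L¹ and L² norms on a finite measure space. In
[0,∞] no integrability is needed. -/
theorem enorm_integral_smul_sq_le [IsFiniteMeasure ν] {a : Y → ℝ} (ha : ∀ y, ‖a y‖ ≤ 1)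
    {g : Y → E} (hg : AEStronglyMeasurable g ν) :
    ‖∫ y, a y • g y ∂ν‖ₑ ^ 2 ≤ ν univ * ∫⁻ y, ‖g y‖ₑ ^ 2 ∂ν := by
  have h1 : ‖∫ y, a y • g y ∂ν‖ₑ ≤ eLpNorm g 1 ν := by
    rw [eLpNorm_one_eq_lintegral_enorm]
    refine (enorm_integral_le_lintegral_enorm _).trans (lintegral_mono fun y => ?_)
    rw [enorm_smul]
    refine (mul_le_mul_left (b := ‖a y‖ₑ) (c := 1) ?_ _).trans (one_mul _).le
    rw [← ofReal_norm]
    simpa using ENNReal.ofReal_le_ofReal (ha y)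
  have h2 := h1.trans (eLpNorm_le_eLpNorm_mul_rpow_measure_univ (p := 1) (q := 2)
    (by norm_num) hg)
  calc _ ≤ _ := pow_le_pow_left₀ zero_le h2 2
    _ = _ := by
      rw [mul_pow, eLpNorm_two_sq, mul_comm, ← ENNReal.rpow_natCast, ← ENNReal.rpow_mul]
      norm_num

theorem aestronglyMeasurable_weightedIntegral [SFinite ν]
    {a : Y → ℝ} (hm : AEStronglyMeasurable a ν) {f : X × Y → E}
    (hf : AEStronglyMeasurable f (μ.prod ν)) :
    AEStronglyMeasurable (weightedIntegral ν a f) μ :=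
  (hm.comp_snd.smul hf).integral_prod_right'

theorem lintegral_weightedIntegral_le [SFinite μ] [IsFiniteMeasure ν] {a : Y → ℝ}
    (ha : ∀ y, ‖a y‖ ≤ 1) {f : X × Y → E} (hf : AEStronglyMeasurable f (μ.prod ν)) :
    ∫⁻ x, ‖weightedIntegral ν a f x‖ₑ ^ 2 ∂μ ≤ ν univ * ∫⁻ z, ‖f z‖ₑ ^ 2 ∂(μ.prod ν) := by
  rw [lintegral_prod _ (hf.enorm.pow_const 2), ← lintegral_const_mul' _ _ (measure_ne_top _ _)]
  refine lintegral_mono_ae ?_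
  filter_upwards [hf.prodMk_left] with x hx
  exact enorm_integral_smul_sq_le ha hx

theorem MeasureTheory.MemLp.weightedIntegral [SFinite μ] [IsFiniteMeasure ν] {a : Y → ℝ}
    (hm : AEStronglyMeasurable a ν) (ha : ∀ y, ‖a y‖ ≤ 1) {f : X × Y → E}
    (hf : MemLp f 2 (μ.prod ν)) : MemLp (weightedIntegral ν a f) 2 μ := by
  refine ⟨aestronglyMeasurable_weightedIntegral hm hf.1, ?_⟩
  have h := lintegral_weightedIntegral_le ha hf.1
  rw [← eLpNorm_two_sq, ← eLpNorm_two_sq] at h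
  have : eLpNorm (_root_.weightedIntegral ν a f) 2 μ ^ 2 < ⊤ :=
    h.trans_lt (ENNReal.mul_lt_top (measure_lt_top _ _) (ENNReal.pow_lt_top hf.2))
  exact (ENNReal.pow_lt_top_iff.1 this).resolve_right two_ne_zero

/-- Extracting a mode with `a` and replaying it with `b` is bounded on L². Half a power of the total
mass comes from Cauchy-Schwarz, the other half from integrating `b` squared. -/
theorem eLpNorm_smul_weightedIntegral_le [SFinite μ] [IsFiniteMeasure ν] {a b : Y → ℝ}
    (ha : ∀ y, ‖a y‖ ≤ 1) (hb : ∀ y, ‖b y‖ ≤ 1)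
    {f : X × Y → E} (hf : AEStronglyMeasurable f (μ.prod ν)) (hm : AEStronglyMeasurable a ν)
    (hbm : AEStronglyMeasurable b ν) :
    eLpNorm (fun z : X × Y => b z.2 • weightedIntegral ν a f z.1) 2 (μ.prod ν)
      ≤ ν univ * eLpNorm f 2 (μ.prod ν) := by
  rw [← ENNReal.pow_le_pow_left_iff two_ne_zero, mul_pow, eLpNorm_two_sq, eLpNorm_two_sq]
  have hI := aestronglyMeasurable_weightedIntegral hm hf
  have hp : AEStronglyMeasurable (fun z : X × Y => b z.2 • weightedIntegral ν a f z.1)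
      (μ.prod ν) := hbm.comp_snd.smul hI.comp_fst
  rw [lintegral_prod _ (hp.enorm.pow_const 2)]
  calc _ ≤ ∫⁻ x, ν univ * ‖weightedIntegral ν a f x‖ₑ ^ 2 ∂μ := by
        refine lintegral_mono fun x => ?_
        rw [mul_comm, ← lintegral_const]
        refine lintegral_mono fun y => ?_
        rw [enorm_smul]
        gcongr
        refine (mul_le_mul_left (b := ‖b y‖ₑ) (c := 1) ?_ _).trans (one_mul _).le
        rw [← ofReal_norm]
        simpa using ENNReal.ofReal_le_ofReal (hb y)
    _ ≤ _ := by
        rw [lintegral_const_mul' _ _ (measure_ne_top _ _), sq, mul_assoc]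
        gcongr
        exact lintegral_weightedIntegral_le ha hf

end ProductMeasure

/-! ### Integrals depending smoothly on a parameter -/

section Parametric

variable {H : Type} [NormedAddCommGroup H] [NormedSpace ℝ H] [FiniteDimensional ℝ H]

/-- Domination comes from compactness: the derivative is continuous, hence bounded on a closed ball
times [0,T]. -/
theorem hasFDerivAt_integral_Ioo_of_contDiff {F : Type} [NormedAddCommGroup F] [NormedSpace ℝ F]
    {T : ℝ} {φ : H × ℝ → F} (hφ : ContDiff ℝ 1 φ) (x₀ : H) :
    HasFDerivAt (fun x => ∫ t in Ioo 0 T, φ (x, t))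
      (∫ t in Ioo 0 T, (fderiv ℝ φ (x₀, t)).comp (ContinuousLinearMap.inl ℝ H ℝ)) x₀ := by
  have : ProperSpace H := FiniteDimensional.proper ℝ H
  have hc : Continuous φ := hφ.continuous
  have hd : Continuous fun z : H × ℝ => (fderiv ℝ φ z).comp (ContinuousLinearMap.inl ℝ H ℝ) :=
    (hφ.continuous_fderiv one_ne_zero).clm_comp continuous_const
  obtain ⟨C, hC⟩ := ((isCompact_closedBall x₀ 1).prod (isCompact_Icc (a := (0 : ℝ)) (b := T))
    ).exists_bound_of_continuousOn hd.continuousOn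
  refine hasFDerivAt_integral_of_dominated_of_fderiv_le (bound := fun _ => C)
    (F' := fun x t => (fderiv ℝ φ (x, t)).comp (ContinuousLinearMap.inl ℝ H ℝ))
    (Metric.closedBall_mem_nhds x₀ one_pos) ?_ ?_ ?_ ?_ ?_ ?_
  · exact Eventually.of_forall fun x => (hc.comp (Continuous.prodMk_right x)).aestronglyMeasurable
  · exact ((hc.comp (Continuous.prodMk_right x₀)).integrableOn_Icc).mono_set Ioo_subset_Icc_self
  · exact (hd.comp (Continuous.prodMk_right x₀)).aestronglyMeasurable
  · refine (ae_restrict_iff' measurableSet_Ioo).2 (ae_of_all _ fun t ht x hx => ?_)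
    exact hC (x, t) ⟨hx, Ioo_subset_Icc_self ht⟩
  · exact integrable_const _
  · refine ae_of_all _ fun t x _ => ?_
    exact ((hφ.differentiable one_ne_zero (x, t)).hasFDerivAt).comp x (hasFDerivAt_prodMk_left x t)

/-- The target space is quantified inside the induction because the derivative takes values in a
different space, that of linear maps into `F`. -/
theorem contDiff_integral_Ioo (n : ℕ) : ∀ {F : Type} [NormedAddCommGroup F] [NormedSpace ℝ F]
    {T : ℝ} {φ : H × ℝ → F}, ContDiff ℝ n φ → ContDiff ℝ n fun x => ∫ t in Ioo 0 T, φ (x, t) := by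
  induction n with
  | zero =>
    intro F _ _ T φ hφ
    have hc : Continuous φ := hφ.continuous
    have h := continuous_parametric_integral_of_continuous (μ := volume) (s := Icc 0 T)
      (f := fun x t => φ (x, t)) hc isCompact_Icc
    simp only [integral_Icc_eq_integral_Ioo] at h
    exact contDiff_zero.2 h
  | succ n ih =>
    intro F _ _ T φ hφ
    have h1 : ContDiff ℝ 1 φ := hφ.of_le (by norm_cast; omega)
    refine contDiff_succ_iff_hasFDerivAt.2 ⟨_, ?_, fun x => hasFDerivAt_integral_Ioo_of_contDiff h1 x⟩
    refine ih (φ := fun z => (fderiv ℝ φ z).comp (ContinuousLinearMap.inl ℝ H ℝ)) ?_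
    exact (hφ.fderiv_right (m := n) (by norm_cast)).clm_comp contDiff_const

theorem contDiff_infty_integral_Ioo {F : Type} [NormedAddCommGroup F] [NormedSpace ℝ F]
    {T : ℝ} {φ : H × ℝ → F} (hφ : ContDiff ℝ ∞ φ) :
    ContDiff ℝ ∞ fun x => ∫ t in Ioo 0 T, φ (x, t) :=
  contDiff_infty.2 fun n => contDiff_integral_Ioo n (contDiff_infty.1 hφ n)

end Parametric

/-! ### Trigonometric polynomials in time -/

section Trigonometric

variable {E : Type*} [NormedAddCommGroup E] [InnerProductSpace ℝ E] {T : ℝ}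

/-- The cosine of angular frequency `kω`. -/
noncomputable def cosMode (T : ℝ) (k : ℕ) (t : ℝ) : ℝ := Real.cos (k * freq T * t)

/-- The sine of angular frequency `kω`. -/
noncomputable def sinMode (T : ℝ) (k : ℕ) (t : ℝ) : ℝ := Real.sin (k * freq T * t)

theorem contDiff_cosMode (T : ℝ) (k : ℕ) : ContDiff ℝ ∞ (cosMode T k) := by
  unfold cosMode; fun_prop

theorem contDiff_sinMode (T : ℝ) (k : ℕ) : ContDiff ℝ ∞ (sinMode T k) := by
  unfold sinMode; fun_prop

@[fun_prop]
theorem continuous_cosMode (T : ℝ) (k : ℕ) : Continuous (cosMode T k) :=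
  (contDiff_cosMode T k).continuous

@[fun_prop]
theorem continuous_sinMode (T : ℝ) (k : ℕ) : Continuous (sinMode T k) :=
  (contDiff_sinMode T k).continuous

theorem norm_cosMode_le (T : ℝ) (k : ℕ) (t : ℝ) : ‖cosMode T k t‖ ≤ 1 := Real.abs_cos_le_one _

theorem norm_sinMode_le (T : ℝ) (k : ℕ) (t : ℝ) : ‖sinMode T k t‖ ≤ 1 := Real.abs_sin_le_one _

theorem integral_cos_int_mul (hT : 0 < T) (m : ℤ) :
    ∫ t in Ioo 0 T, Real.cos (m * freq T * t) = if m = 0 then T else 0 := by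
  rw [← integral_Ioc_eq_integral_Ioo, ← intervalIntegral.integral_of_le hT.le]
  split_ifs with h
  · simp [h]
  · have hf : (m : ℝ) * freq T ≠ 0 := by
      have := Real.pi_pos
      unfold freq
      have : (m : ℝ) ≠ 0 := by exact_mod_cast h
      positivity
    rw [intervalIntegral.integral_comp_mul_left (f := Real.cos) hf, integral_cos]
    have : (m : ℝ) * freq T * T = m * (2 * Real.pi) := by unfold freq; field_simp
    have h2 : Real.sin (m * (2 * Real.pi)) = 0 := by
      have := Real.sin_int_mul_pi (m * 2)
      push_cast at this
      rw [← this]; congr 1; ring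
    rw [this, h2]; simp

theorem integral_sin_int_mul (hT : 0 < T) (m : ℤ) :
    ∫ t in Ioo 0 T, Real.sin (m * freq T * t) = 0 := by
  rw [← integral_Ioc_eq_integral_Ioo, ← intervalIntegral.integral_of_le hT.le]
  by_cases h : m = 0
  · simp [h]
  · have hf : (m : ℝ) * freq T ≠ 0 := by
      have := Real.pi_pos
      unfold freq
      have : (m : ℝ) ≠ 0 := by exact_mod_cast h
      positivity
    rw [intervalIntegral.integral_comp_mul_left (f := Real.sin) hf, integral_sin]
    have : (m : ℝ) * freq T * T = m * (2 * Real.pi) := by unfold freq; field_simp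
    rw [this, Real.cos_int_mul_two_pi]; simp

theorem integrable_of_continuous_Ioo {F : Type*} [NormedAddCommGroup F] {g : ℝ → F}
    (hg : Continuous g) : Integrable g (volume.restrict (Ioo 0 T)) :=
  hg.integrableOn_Icc.mono_set Ioo_subset_Icc_self

/-- The condition `k ≠ 0` makes the sum frequency j + k nonzero; for j = k = 0 the integral would be
T. This is why index sets below exclude 0. -/
theorem integral_cosMode_mul_cosMode (hT : 0 < T) (j : ℕ) {k : ℕ} (hk : k ≠ 0) :
    ∫ t in Ioo 0 T, cosMode T j t * cosMode T k t = if j = k then T / 2 else 0 := by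
  have h : ∀ t, cosMode T j t * cosMode T k t =
      1 / 2 * Real.cos (((j : ℤ) - k : ℤ) * freq T * t)
        + 1 / 2 * Real.cos (((j : ℤ) + k : ℤ) * freq T * t) := fun t => by
    have h1 := Real.cos_sub (j * freq T * t) (k * freq T * t)
    have h2 := Real.cos_add (j * freq T * t) (k * freq T * t)
    push_cast
    rw [sub_mul, sub_mul, add_mul, add_mul, h1, h2]
    unfold cosMode; ring
  simp_rw [h]
  rw [integral_add (integrable_of_continuous_Ioo (by fun_prop))
    (integrable_of_continuous_Ioo (by fun_prop)), integral_const_mul, integral_const_mul,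
    integral_cos_int_mul hT, integral_cos_int_mul hT, if_neg (by omega : ¬ ((j : ℤ) + k = 0))]
  by_cases hjk : j = k
  · simp [hjk]; ring
  · rw [if_neg hjk, if_neg (by omega)]; simp

theorem integral_sinMode_mul_sinMode (hT : 0 < T) (j : ℕ) {k : ℕ} (hk : k ≠ 0) :
    ∫ t in Ioo 0 T, sinMode T j t * sinMode T k t = if j = k then T / 2 else 0 := by
  have h : ∀ t, sinMode T j t * sinMode T k t =
      1 / 2 * Real.cos (((j : ℤ) - k : ℤ) * freq T * t)
        - 1 / 2 * Real.cos (((j : ℤ) + k : ℤ) * freq T * t) := fun t => by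
    have h1 := Real.cos_sub (j * freq T * t) (k * freq T * t)
    have h2 := Real.cos_add (j * freq T * t) (k * freq T * t)
    push_cast
    rw [sub_mul, sub_mul, add_mul, add_mul, h1, h2]
    unfold sinMode; ring
  simp_rw [h]
  rw [integral_sub (integrable_of_continuous_Ioo (by fun_prop))
    (integrable_of_continuous_Ioo (by fun_prop)), integral_const_mul, integral_const_mul,
    integral_cos_int_mul hT, integral_cos_int_mul hT, if_neg (by omega : ¬ ((j : ℤ) + k = 0))]
  by_cases hjk : j = k
  · simp [hjk]; ring
  · rw [if_neg hjk, if_neg (by omega)]; simp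

theorem integral_sinMode_mul_cosMode (hT : 0 < T) (j k : ℕ) :
    ∫ t in Ioo 0 T, sinMode T j t * cosMode T k t = 0 := by
  have h : ∀ t, sinMode T j t * cosMode T k t =
      1 / 2 * Real.sin (((j : ℤ) - k : ℤ) * freq T * t)
        + 1 / 2 * Real.sin (((j : ℤ) + k : ℤ) * freq T * t) := fun t => by
    have h1 := Real.sin_sub (j * freq T * t) (k * freq T * t)
    have h2 := Real.sin_add (j * freq T * t) (k * freq T * t)
    push_cast
    rw [sub_mul, sub_mul, add_mul, add_mul, h1, h2]
    unfold sinMode cosMode; ring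
  simp_rw [h]
  rw [integral_add (integrable_of_continuous_Ioo (by fun_prop))
    (integrable_of_continuous_Ioo (by fun_prop)), integral_const_mul, integral_const_mul,
    integral_sin_int_mul hT, integral_sin_int_mul hT]
  simp

/-- The trigonometric polynomial `∑ (cos (kωt) A k + sin (kωt) D k)`. -/
noncomputable def trigPoly (T : ℝ) (s : Finset ℕ) (A D : ℕ → E) (t : ℝ) : E :=
  ∑ k ∈ s, (cosMode T k t • A k + sinMode T k t • D k)

theorem continuous_trigPoly (s : Finset ℕ) (A D : ℕ → E) : Continuous (trigPoly T s A D) := by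
  unfold trigPoly; fun_prop

theorem integrable_bdd_smul {ν : Measure ℝ} {a : ℝ → ℝ} (ha : Continuous a)
    (hb : ∀ t, ‖a t‖ ≤ 1) {g : ℝ → E} (hg : Integrable g ν) : Integrable (fun t => a t • g t) ν :=
  hg.bdd_smul 1 ha.aestronglyMeasurable (ae_of_all _ hb)

variable [CompleteSpace E]

theorem integral_cosMode_smul_trigPoly (hT : 0 < T) {s : Finset ℕ} (hs : 0 ∉ s) (A D : ℕ → E)
    (j : ℕ) : ∫ t in Ioo 0 T, cosMode T j t • trigPoly T s A D t
      = (T / 2) • if j ∈ s then A j else 0 := by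
  simp_rw [trigPoly, Finset.smul_sum, smul_add, smul_smul]
  rw [integral_finsetSum _ fun k _ => integrable_of_continuous_Ioo (by fun_prop)]
  have h : ∀ k ∈ s, ∫ t in Ioo 0 T, ((cosMode T j t * cosMode T k t) • A k
      + (cosMode T j t * sinMode T k t) • D k) = if j = k then (T / 2) • A k else 0 := by
    intro k hk
    rw [integral_add (integrable_of_continuous_Ioo (by fun_prop))
      (integrable_of_continuous_Ioo (by fun_prop)), integral_smul_const, integral_smul_const,
      integral_cosMode_mul_cosMode hT j (ne_of_mem_of_not_mem hk hs)]
    simp_rw [mul_comm (cosMode T j _) (sinMode T k _)]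
    rw [integral_sinMode_mul_cosMode hT]
    split_ifs <;> simp
  rw [Finset.sum_congr rfl h, Finset.sum_ite_eq]
  split_ifs <;> simp

theorem integral_sinMode_smul_trigPoly (hT : 0 < T) {s : Finset ℕ} (hs : 0 ∉ s) (A D : ℕ → E)
    (j : ℕ) : ∫ t in Ioo 0 T, sinMode T j t • trigPoly T s A D t
      = (T / 2) • if j ∈ s then D j else 0 := by
  simp_rw [trigPoly, Finset.smul_sum, smul_add, smul_smul]
  rw [integral_finsetSum _ fun k _ => integrable_of_continuous_Ioo (by fun_prop)]
  have h : ∀ k ∈ s, ∫ t in Ioo 0 T, ((sinMode T j t * cosMode T k t) • A k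
      + (sinMode T j t * sinMode T k t) • D k) = if j = k then (T / 2) • D k else 0 := by
    intro k hk
    rw [integral_add (integrable_of_continuous_Ioo (by fun_prop))
      (integrable_of_continuous_Ioo (by fun_prop)), integral_smul_const, integral_smul_const,
      integral_sinMode_mul_sinMode hT j (ne_of_mem_of_not_mem hk hs),
      integral_sinMode_mul_cosMode hT]
    split_ifs <;> simp
  rw [Finset.sum_congr rfl h, Finset.sum_ite_eq]
  split_ifs <;> simp

/-- A pairing with a trigonometric polynomial sees only the Fourier moments of `g`; Parseval, Bessel
and conjugate orthogonality all follow from it. -/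
theorem integral_inner_trigPoly {g : ℝ → E} (hg : Integrable g (volume.restrict (Ioo 0 T)))
    (s : Finset ℕ) (A D : ℕ → E) :
    ∫ t in Ioo 0 T, inner ℝ (g t) (trigPoly T s A D t)
      = ∑ k ∈ s, (inner ℝ (∫ t in Ioo 0 T, cosMode T k t • g t) (A k)
        + inner ℝ (∫ t in Ioo 0 T, sinMode T k t • g t) (D k)) := by
  have hc := fun k => integrable_bdd_smul (continuous_cosMode T k) (norm_cosMode_le T k) hg
  have hs := fun k => integrable_bdd_smul (continuous_sinMode T k) (norm_sinMode_le T k) hg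
  have h : ∀ t, inner ℝ (g t) (trigPoly T s A D t)
      = ∑ k ∈ s, (inner ℝ (A k) (cosMode T k t • g t) + inner ℝ (D k) (sinMode T k t • g t)) := by
    intro t
    simp [trigPoly, inner_sum, inner_add_right, inner_smul_right, real_inner_comm]
  simp_rw [h]
  rw [integral_finsetSum _ fun k _ => ((hc k).const_inner _).add ((hs k).const_inner _)]
  refine Finset.sum_congr rfl fun k _ => ?_
  rw [integral_add ((hc k).const_inner _) ((hs k).const_inner _), integral_inner (hc k),
    integral_inner (hs k), real_inner_comm, real_inner_comm (D k)]

theorem integral_norm_sq_trigPoly (hT : 0 < T) {s : Finset ℕ} (hs : 0 ∉ s) (A D : ℕ → E) :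
    ∫ t in Ioo 0 T, ‖trigPoly T s A D t‖ ^ 2 = T / 2 * ∑ k ∈ s, (‖A k‖ ^ 2 + ‖D k‖ ^ 2) := by
  simp_rw [← real_inner_self_eq_norm_sq (trigPoly T s A D _)]
  rw [integral_inner_trigPoly (integrable_of_continuous_Ioo (continuous_trigPoly s A D)),
    Finset.mul_sum]
  refine Finset.sum_congr rfl fun k hk => ?_
  rw [integral_cosMode_smul_trigPoly hT hs, integral_sinMode_smul_trigPoly hT hs, if_pos hk,
    if_pos hk, real_inner_smul_left, real_inner_smul_left, real_inner_self_eq_norm_sq,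
    real_inner_self_eq_norm_sq]
  ring

/-- Bessel's inequality for the conjugate trigonometric polynomial. -/
theorem integral_norm_sq_conjugate_trigPoly_le (hT : 0 < T) {s : Finset ℕ} (hs : 0 ∉ s)
    {g : ℝ → E} (hg : MemLp g 2 (volume.restrict (Ioo 0 T))) {A D : ℕ → E}
    (hA : ∀ k, ∫ t in Ioo 0 T, cosMode T k t • g t = (T / 2) • A k)
    (hD : ∀ k, ∫ t in Ioo 0 T, sinMode T k t • g t = (T / 2) • D k) :
    ∫ t in Ioo 0 T, ‖trigPoly T s D (fun k => -A k) t‖ ^ 2 ≤ ∫ t in Ioo 0 T, ‖g t‖ ^ 2 := by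
  have hg1 : Integrable g (volume.restrict (Ioo 0 T)) := hg.integrable one_le_two
  have hp : MemLp (trigPoly T s A D) 2 (volume.restrict (Ioo 0 T)) :=
    (memLp_two_iff_integrable_sq_norm (continuous_trigPoly s A D).aestronglyMeasurable).2
      (integrable_of_continuous_Ioo ((continuous_trigPoly s A D).norm.pow 2))
  have h1 := integral_norm_sq_trigPoly hT hs A D
  have h2 := integral_inner_trigPoly hg1 s A D
  simp_rw [hA, hD, real_inner_smul_left, real_inner_self_eq_norm_sq, ← mul_add] at h2
  rw [← Finset.mul_sum] at h2
  -- Bessel is proved for the unconjugated partial sum. Conjugation only swaps coefficients and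
  -- changes a sign, so both polynomials have the same norm.
  have h3 : 0 ≤ ∫ t in Ioo 0 T, ‖g t - trigPoly T s A D t‖ ^ 2 :=
    integral_nonneg fun t => by positivity
  simp_rw [norm_sub_sq_real] at h3
  have hgg := (memLp_two_iff_integrable_sq_norm hg.1).1 hg
  have hpp := (memLp_two_iff_integrable_sq_norm hp.1).1 hp
  have hgp : Integrable (fun t => inner ℝ (g t) (trigPoly T s A D t))
    (volume.restrict (Ioo 0 T)) := hg.integrable_inner hp
  have hi := hgg.sub (hgp.const_mul 2)
  simp only [Pi.sub_def] at hi
  rw [integral_add hi hpp, integral_sub hgg (hgp.const_mul 2),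
    integral_const_mul, h1, h2] at h3
  rw [integral_norm_sq_trigPoly hT hs]
  simp only [norm_neg]
  simp_rw [add_comm (‖D _‖ ^ 2)]
  linarith

/-- Mode by mode the contribution is a multiple of ⟨A, D⟩ - ⟨D, A⟩, which vanishes by symmetry. -/
theorem integral_inner_conjugate_trigPoly {g : ℝ → E}
    (hg : Integrable g (volume.restrict (Ioo 0 T))) (s : Finset ℕ) {A D : ℕ → E}
    (hA : ∀ k, ∫ t in Ioo 0 T, cosMode T k t • g t = (T / 2) • A k)
    (hD : ∀ k, ∫ t in Ioo 0 T, sinMode T k t • g t = (T / 2) • D k) :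
    ∫ t in Ioo 0 T, inner ℝ (g t) (trigPoly T s D (fun k => -A k) t) = 0 := by
  rw [integral_inner_trigPoly hg]
  refine Finset.sum_eq_zero fun k _ => ?_
  rw [hA, hD, real_inner_smul_left, real_inner_smul_left, inner_neg_right, real_inner_comm]
  ring

end Trigonometric

/-! ### Spatial gradients -/

section Gradients

variable {d : ℕ} {φ : Sp d × ℝ → ℝ}

theorem spaceGrad_eq_of_hasFDerivAt {z : Sp d × ℝ} {g : Sp d}
    (h : HasFDerivAt (fun x => φ (x, z.2)) (innerSL ℝ g) z.1) : spaceGrad φ z = g :=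
  (hasGradientAt_iff_hasFDerivAt.2 h).gradient

theorem hasFDerivAt_slice (hφ : ContDiff ℝ 1 φ) (z : Sp d × ℝ) :
    HasFDerivAt (fun x => φ (x, z.2))
      ((fderiv ℝ φ z).comp (ContinuousLinearMap.inl ℝ (Sp d) ℝ)) z.1 :=
  ((hφ.differentiable one_ne_zero z).hasFDerivAt).comp z.1 (hasFDerivAt_prodMk_left z.1 z.2)

theorem hasFDerivAt_spaceGrad (hφ : ContDiff ℝ 1 φ) (z : Sp d × ℝ) :
    HasFDerivAt (fun x => φ (x, z.2)) (innerSL ℝ (spaceGrad φ z)) z.1 :=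
  ((hasFDerivAt_slice hφ z).differentiableAt.hasGradientAt).hasFDerivAt

theorem innerSL_spaceGrad (hφ : ContDiff ℝ 1 φ) (z : Sp d × ℝ) :
    innerSL ℝ (spaceGrad φ z) = (fderiv ℝ φ z).comp (ContinuousLinearMap.inl ℝ (Sp d) ℝ) :=
  (hasFDerivAt_spaceGrad hφ z).unique (hasFDerivAt_slice hφ z)

theorem continuous_spaceGrad (hφ : ContDiff ℝ 1 φ) : Continuous (spaceGrad φ) := by
  have h : spaceGrad φ = fun z => (InnerProductSpace.toDual ℝ (Sp d)).symm
      ((fderiv ℝ φ z).comp (ContinuousLinearMap.inl ℝ (Sp d) ℝ)) := by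
    funext z
    rw [LinearIsometryEquiv.eq_symm_apply, ← innerSL_spaceGrad hφ z]
    rfl
  rw [h]
  exact (LinearIsometryEquiv.continuous _).comp
    ((hφ.continuous_fderiv one_ne_zero).clm_comp continuous_const)

theorem spaceGrad_linearCombination {ψ : Sp d × ℝ → ℝ} (hφ : ContDiff ℝ 1 φ)
    (hψ : ContDiff ℝ 1 ψ) (α β : ℝ) (z : Sp d × ℝ) :
    spaceGrad (fun z => α * φ z + β * ψ z) z = α • spaceGrad φ z + β • spaceGrad ψ z := by
  refine spaceGrad_eq_of_hasFDerivAt ?_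
  rw [map_add, map_smul, map_smul]
  exact ((hasFDerivAt_spaceGrad hφ z).const_mul α).add ((hasFDerivAt_spaceGrad hψ z).const_mul β)

/-- The weights depend on time only, so differentiation under the integral sign moves the spatial
gradient past them. -/
theorem spaceGrad_smul_weightedIntegral {T : ℝ} {a b : ℝ → ℝ} (ha : ContDiff ℝ ∞ a)
    (hφ : ContDiff ℝ ∞ φ) (z : Sp d × ℝ) :
    spaceGrad (fun z => b z.2 • weightedIntegral (volume.restrict (Ioo 0 T)) a φ z.1) z
      = b z.2 • weightedIntegral (volume.restrict (Ioo 0 T)) a (spaceGrad φ) z.1 := by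
  refine spaceGrad_eq_of_hasFDerivAt ?_
  rw [map_smul]
  suffices h : HasFDerivAt (weightedIntegral (volume.restrict (Ioo 0 T)) a φ)
      (innerSL ℝ (weightedIntegral (volume.restrict (Ioo 0 T)) a (spaceGrad φ) z.1)) z.1 from
    h.const_smul (b z.2)
  have h1 : ContDiff ℝ 1 fun z : Sp d × ℝ => a z.2 • φ z :=
    ((ha.comp contDiff_snd).smul hφ).of_le (by norm_cast)
  have hφ1 : ContDiff ℝ 1 φ := hφ.of_le (by norm_cast)
  have hc : Continuous fun t => a t • spaceGrad φ (z.1, t) :=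
    ha.continuous.smul ((continuous_spaceGrad hφ1).comp (Continuous.prodMk_right z.1))
  have h2 : ∀ t, (fderiv ℝ (fun z : Sp d × ℝ => a z.2 • φ z) (z.1, t)).comp
      (ContinuousLinearMap.inl ℝ (Sp d) ℝ) = innerSL ℝ (a t • spaceGrad φ (z.1, t)) := by
    intro t
    rw [map_smul]
    exact (hasFDerivAt_slice h1 (z.1, t)).unique
      ((hasFDerivAt_spaceGrad hφ1 (z.1, t)).const_smul (a t))
  have h3 := hasFDerivAt_integral_Ioo_of_contDiff (T := T) h1 z.1
  rw [integral_congr_ae (ae_of_all _ h2),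
    (innerSL ℝ).integral_comp_comm (integrable_of_continuous_Ioo hc)] at h3
  exact h3

end Gradients

/-! ### The space `H^{1,0}_0(Q)` -/

section LateralZero

variable {d : ℕ} {Ω : Set (Sp d)} {T : ℝ}

theorem volQ_eq_prod (Ω : Set (Sp d)) (T : ℝ) :
    volQ Ω T = (volume.restrict Ω).prod (volume.restrict (Ioo 0 T)) := by
  rw [volQ, Measure.volume_eq_prod, Measure.prod_restrict]

theorem tendsto_eLpNorm_linearCombination {E : Type*} [NormedAddCommGroup E] [NormedSpace ℝ E]
    {X : Type*} [MeasurableSpace X] {μ : Measure X} {f g : ℕ → X → E} (α β : ℝ)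
    (hf : ∀ n, AEStronglyMeasurable (f n) μ) (hg : ∀ n, AEStronglyMeasurable (g n) μ)
    (hf0 : Tendsto (fun n => eLpNorm (f n) 2 μ) atTop (𝓝 0))
    (hg0 : Tendsto (fun n => eLpNorm (g n) 2 μ) atTop (𝓝 0)) :
    Tendsto (fun n => eLpNorm (fun x => α • f n x + β • g n x) 2 μ) atTop (𝓝 0) := by
  have h : Tendsto (fun n => ‖α‖ₑ * eLpNorm (f n) 2 μ + ‖β‖ₑ * eLpNorm (g n) 2 μ) atTop (𝓝 0) := by
    have := (ENNReal.Tendsto.const_mul hf0 (Or.inr (enorm_ne_top (x := α)))).add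
      (ENNReal.Tendsto.const_mul hg0 (Or.inr (enorm_ne_top (x := β))))
    simpa using this
  refine tendsto_of_tendsto_of_tendsto_of_le_of_le tendsto_const_nhds h (fun _ => zero_le)
    fun n => ?_
  refine (eLpNorm_add_le ((hf n).const_smul α) ((hg n).const_smul β) one_le_two).trans ?_
  rw [eLpNorm_const_smul, eLpNorm_const_smul]

theorem ContDiff.one_of_infty {F : Type*} [NormedAddCommGroup F] [NormedSpace ℝ F]
    {φ : F → ℝ} (h : ContDiff ℝ ∞ φ) : ContDiff ℝ 1 φ :=
  h.of_le (by norm_cast)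

theorem IsH10Zero.linearCombination {y₁ y₂ : Sp d × ℝ → ℝ} {G₁ G₂ : Sp d × ℝ → Sp d}
    (h₁ : IsH10Zero Ω T y₁ G₁) (h₂ : IsH10Zero Ω T y₂ G₂) (α β : ℝ) :
    IsH10Zero Ω T (fun z => α * y₁ z + β * y₂ z) (fun z => α • G₁ z + β • G₂ z) := by
  obtain ⟨hy₁, hG₁, φ, hφ, hφy, hφG⟩ := h₁
  obtain ⟨hy₂, hG₂, ψ, hψ, hψy, hψG⟩ := h₂
  refine ⟨(hy₁.const_mul α).add (hy₂.const_mul β), (hG₁.const_smul α).add (hG₂.const_smul β),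
    fun n z => α * φ n z + β * ψ n z, fun n => ⟨?_, ?_⟩, ?_, ?_⟩
  · exact (contDiff_const.mul (hφ n).1).add (contDiff_const.mul (hψ n).1)
  · obtain ⟨K, hK, hKΩ, hK0⟩ := (hφ n).2
    obtain ⟨L, hL, hLΩ, hL0⟩ := (hψ n).2
    refine ⟨K ∪ L, hK.union hL, union_subset hKΩ hLΩ, fun x t hx => ?_⟩
    rw [mem_union, not_or] at hx
    simp [hK0 x t hx.1, hL0 x t hx.2]
  · have h := tendsto_eLpNorm_linearCombination α β
      (fun n => (hφ n).1.continuous.aestronglyMeasurable.sub hy₁.1)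
      (fun n => (hψ n).1.continuous.aestronglyMeasurable.sub hy₂.1) hφy hψy
    refine h.congr fun n => ?_
    congr 1; funext z
    simp only [Pi.sub_apply, smul_eq_mul]
    ring
  · have h := tendsto_eLpNorm_linearCombination α β
      (fun n => (continuous_spaceGrad (hφ n).1.one_of_infty).aestronglyMeasurable.sub hG₁.1)
      (fun n => (continuous_spaceGrad (hψ n).1.one_of_infty).aestronglyMeasurable.sub hG₂.1)
      hφG hψG
    refine h.congr fun n => ?_
    congr 1; funext z
    rw [spaceGrad_linearCombination (hφ n).1.one_of_infty (hψ n).1.one_of_infty]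
    simp only [Pi.sub_apply]; module

theorem IsH10Zero.zero : IsH10Zero Ω T (fun _ => 0) (fun _ => 0) := by
  have hg : ∀ z : Sp d × ℝ, spaceGrad (fun _ => (0 : ℝ)) z = 0 := fun z =>
    spaceGrad_eq_of_hasFDerivAt (by simpa using hasFDerivAt_const (0 : ℝ) z.1)
  refine ⟨MemLp.zero', MemLp.zero', fun _ _ => 0,
    fun _ => ⟨contDiff_const, ∅, isCompact_empty, empty_subset _, fun _ _ _ => rfl⟩, ?_, ?_⟩
  · simp
  · simp [hg]

theorem IsH10Zero.sum {ι : Type*} (s : Finset ι) {y : ι → Sp d × ℝ → ℝ}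
    {G : ι → Sp d × ℝ → Sp d} (h : ∀ i, IsH10Zero Ω T (y i) (G i)) :
    IsH10Zero Ω T (fun z => ∑ i ∈ s, y i z) (fun z => ∑ i ∈ s, G i z) := by
  classical
  induction s using Finset.induction_on with
  | empty => simpa using IsH10Zero.zero
  | insert i s hi ih =>
    simpa [Finset.sum_insert hi] using (h i).linearCombination ih 1 1

theorem weightedIntegral_sub_ae {X Y E : Type*} [MeasurableSpace X] [MeasurableSpace Y]
    {μ : Measure X} {ν : Measure Y} [SFinite μ] [IsFiniteMeasure ν] [NormedAddCommGroup E]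
    [NormedSpace ℝ E] {a : Y → ℝ} (ha : AEStronglyMeasurable a ν) (hb : ∀ y, ‖a y‖ ≤ 1)
    {f g : X × Y → E} (hf : ∀ x, Integrable (fun y => f (x, y)) ν) (hg : MemLp g 2 (μ.prod ν)) :
    ∀ᵐ x ∂μ, weightedIntegral ν a f x - weightedIntegral ν a g x
      = weightedIntegral ν a (fun z => f z - g z) x := by
  filter_upwards [hg.ae_slice] with x hx
  unfold weightedIntegral
  have hi : Integrable (fun y => a y • f (x, y)) ν := (hf x).bdd_smul 1 ha (ae_of_all _ hb)
  have hj : Integrable (fun y => a y • g (x, y)) ν :=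
    (hx.integrable one_le_two).bdd_smul 1 ha (ae_of_all _ hb)
  rw [← integral_sub hi hj]
  simp_rw [smul_sub]

theorem eLpNorm_modulate_sub_le {E : Type*} [NormedAddCommGroup E]
    [NormedSpace ℝ E] {a b : ℝ → ℝ} (ha : Continuous a) (hb : Continuous b)
    (ha1 : ∀ t, ‖a t‖ ≤ 1) (hb1 : ∀ t, ‖b t‖ ≤ 1) {f g : Sp d × ℝ → E}
    (hf : Continuous f) (hg : MemLp g 2 (volQ Ω T)) :
    eLpNorm (fun z => b z.2 • weightedIntegral (volume.restrict (Ioo 0 T)) a f z.1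
      - b z.2 • weightedIntegral (volume.restrict (Ioo 0 T)) a g z.1) 2 (volQ Ω T)
      ≤ ENNReal.ofReal T * eLpNorm (fun z => f z - g z) 2 (volQ Ω T) := by
  rw [volQ_eq_prod] at hg ⊢
  have h := eLpNorm_smul_weightedIntegral_le (μ := volume.restrict Ω)
    (ν := volume.restrict (Ioo 0 T)) ha1 hb1 (f := fun z => f z - g z)
    (hf.aestronglyMeasurable.sub hg.1) ha.aestronglyMeasurable hb.aestronglyMeasurable
  rw [show (volume.restrict (Ioo 0 T)) univ = ENNReal.ofReal T by simp] at h
  refine le_trans (eLpNorm_congr_ae ?_).le h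
  have hae := weightedIntegral_sub_ae (μ := volume.restrict Ω) ha.aestronglyMeasurable ha1
    (fun x => integrable_of_continuous_Ioo (T := T) (hf.comp (Continuous.prodMk_right x))) hg
  filter_upwards [Measure.quasiMeasurePreserving_fst.ae hae] with z hz
  rw [← smul_sub]
  exact congrArg (b z.2 • ·) hz

theorem memLp_modulate {E : Type*} [NormedAddCommGroup E]
    [NormedSpace ℝ E] {a b : ℝ → ℝ} (ha : Continuous a) (hb : Continuous b)
    (ha1 : ∀ t, ‖a t‖ ≤ 1) (hb1 : ∀ t, ‖b t‖ ≤ 1) {g : Sp d × ℝ → E}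
    (hg : MemLp g 2 (volQ Ω T)) :
    MemLp (fun z => b z.2 • weightedIntegral (volume.restrict (Ioo 0 T)) a g z.1) 2
      (volQ Ω T) := by
  rw [volQ_eq_prod] at hg ⊢
  exact memLp_two_bdd_smul hb.aestronglyMeasurable.comp_snd (ae_of_all _ fun z => hb1 z.2)
    ((hg.weightedIntegral ha.aestronglyMeasurable ha1).comp_fst _)

theorem tendsto_zero_of_le_const_mul {u w : ℕ → ℝ≥0∞} {C : ℝ≥0∞} (hC : C ≠ ⊤)
    (h : ∀ n, u n ≤ C * w n) (hw : Tendsto w atTop (𝓝 0)) : Tendsto u atTop (𝓝 0) := by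
  have h2 := ENNReal.Tendsto.const_mul hw (Or.inr hC)
  rw [mul_zero] at h2
  exact tendsto_of_tendsto_of_tendsto_of_le_of_le tendsto_const_nhds h2 (fun _ => zero_le) h

/-- The operation is applied to the approximating smooth functions. Integrating in time keeps them
smooth and zero outside the same compact set of Ω; its L² boundedness and its commutation with the
gradient give both limits. -/
theorem IsH10Zero.modulate {y : Sp d × ℝ → ℝ} {G : Sp d × ℝ → Sp d} (h : IsH10Zero Ω T y G)
    {a b : ℝ → ℝ} (ha : ContDiff ℝ ∞ a) (hb : ContDiff ℝ ∞ b)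
    (ha1 : ∀ t, ‖a t‖ ≤ 1) (hb1 : ∀ t, ‖b t‖ ≤ 1) :
    IsH10Zero Ω T (fun z => b z.2 • weightedIntegral (volume.restrict (Ioo 0 T)) a y z.1)
      (fun z => b z.2 • weightedIntegral (volume.restrict (Ioo 0 T)) a G z.1) := by
  obtain ⟨hy, hG, φ, hφ, hφy, hφG⟩ := h
  refine ⟨memLp_modulate ha.continuous hb.continuous ha1 hb1 hy,
    memLp_modulate ha.continuous hb.continuous ha1 hb1 hG,
    fun n z => b z.2 • weightedIntegral (volume.restrict (Ioo 0 T)) a (φ n) z.1,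
    fun n => ⟨?_, ?_⟩, ?_, ?_⟩
  · refine (hb.comp contDiff_snd).smul (ContDiff.comp (g := weightedIntegral _ a (φ n)) ?_
      contDiff_fst)
    exact contDiff_infty_integral_Ioo (φ := fun z => a z.2 • φ n z)
      ((ha.comp contDiff_snd).smul (hφ n).1)
  · obtain ⟨K, hK, hKΩ, hK0⟩ := (hφ n).2
    refine ⟨K, hK, hKΩ, fun x t hx => ?_⟩
    simp [weightedIntegral, hK0 x _ hx]
  · exact tendsto_zero_of_le_const_mul ENNReal.ofReal_ne_top (fun n =>
      eLpNorm_modulate_sub_le ha.continuous hb.continuous ha1 hb1 (hφ n).1.continuous hy) hφy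
  · refine tendsto_zero_of_le_const_mul (C := ENNReal.ofReal T) ENNReal.ofReal_ne_top (fun n => ?_) hφG
    simp_rw [spaceGrad_smul_weightedIntegral ha (hφ n).1]
    exact eLpNorm_modulate_sub_le ha.continuous hb.continuous ha1 hb1
      (continuous_spaceGrad (hφ n).1.one_of_infty) hG

/-! ### Friedrichs' inequality on the cylinder -/

theorem isH1Zero_of_contDiff {w : Sp d → ℝ} (hw : ContDiff ℝ ∞ w) (hc : HasCompactSupport w)
    (hs : tsupport w ⊆ Ω) (hg : Continuous (gradient w)) : IsH1Zero Ω w (gradient w) := by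
  have hgc : HasCompactSupport (gradient w) := by
    refine (hc.fderiv ℝ).mono fun x hx => ?_
    contrapose! hx
    simp only [Function.mem_support, not_not] at hx ⊢
    simp [gradient, hx]
  refine ⟨(hw.continuous.memLp_of_hasCompactSupport hc).restrict _,
    (hg.memLp_of_hasCompactSupport hgc).restrict _, fun _ => w, fun _ => ⟨hw, hc, hs⟩, ?_, ?_⟩ <;>
  simp

theorem IsFriedrichsConst.lintegral_le {C : ℝ} (hC : IsFriedrichsConst Ω C) {w : Sp d → ℝ}
    {g : Sp d → Sp d} (h : IsH1Zero Ω w g) :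
    ∫⁻ x in Ω, ‖w x‖ₑ ^ 2 ≤ ENNReal.ofReal C ^ 2 * ∫⁻ x in Ω, ‖g x‖ₑ ^ 2 := by
  rw [← eLpNorm_two_sq, ← eLpNorm_two_sq, ← h.1.ofReal_integral_norm_sq,
    ← h.2.1.ofReal_integral_norm_sq, ← ENNReal.ofReal_pow hC.1.le,
    ← ENNReal.ofReal_mul (by positivity)]
  refine ENNReal.ofReal_le_ofReal ?_
  simpa using hC.2 w g h

/-- Each time slice is a test function on Ω, so Friedrichs' inequality holds slice by slice and
Tonelli integrates it. Proving this first for smooth functions avoids discussing slices of a general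
element of the closure. -/
theorem IsFriedrichsConst.eLpNorm_smooth_le {C : ℝ} (hC : IsFriedrichsConst Ω C)
    {φ : Sp d × ℝ → ℝ} (hφ : ContDiff ℝ ∞ φ) {K : Set (Sp d)} (hK : IsCompact K) (hKΩ : K ⊆ Ω)
    (hK0 : ∀ x t, x ∉ K → φ (x, t) = 0) :
    eLpNorm φ 2 (volQ Ω T) ≤ ENNReal.ofReal C * eLpNorm (spaceGrad φ) 2 (volQ Ω T) := by
  rw [← ENNReal.pow_le_pow_left_iff two_ne_zero, mul_pow, eLpNorm_two_sq, eLpNorm_two_sq,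
    volQ_eq_prod]
  have hgc := continuous_spaceGrad hφ.one_of_infty
  rw [lintegral_prod_symm _ (hφ.continuous.enorm.measurable.pow_const 2).aemeasurable,
    lintegral_prod_symm _ (hgc.enorm.measurable.pow_const 2).aemeasurable,
    ← lintegral_const_mul' _ _ (ENNReal.pow_ne_top ENNReal.ofReal_ne_top)]
  refine lintegral_mono fun t => ?_
  have hsl : ContDiff ℝ ∞ fun x => φ (x, t) := hφ.comp (contDiff_prodMk_left t)
  have hts : tsupport (fun x => φ (x, t)) ⊆ K := by
    refine closure_minimal (fun x hx => ?_) hK.isClosed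
    by_contra hxK
    exact hx (hK0 x t hxK)
  exact hC.lintegral_le (isH1Zero_of_contDiff hsl
    (HasCompactSupport.intro hK fun x hx => hK0 x t hx) (hts.trans hKΩ)
    (hgc.comp (Continuous.prodMk_left t)))

theorem IsH10Zero.eLpNorm_le {C : ℝ} (hC : IsFriedrichsConst Ω C) {y : Sp d × ℝ → ℝ}
    {G : Sp d × ℝ → Sp d} (h : IsH10Zero Ω T y G) :
    eLpNorm y 2 (volQ Ω T) ≤ ENNReal.ofReal C * eLpNorm G 2 (volQ Ω T) := by
  obtain ⟨hy, hG, φ, hφ, hφy, hφG⟩ := h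
  have hlim : Tendsto (fun n => eLpNorm (fun z => φ n z - y z) 2 (volQ Ω T)
      + ENNReal.ofReal C * (eLpNorm (fun z => spaceGrad (φ n) z - G z) 2 (volQ Ω T)
        + eLpNorm G 2 (volQ Ω T))) atTop (𝓝 (0 + ENNReal.ofReal C * (0 + eLpNorm G 2 (volQ Ω T)))) :=
    hφy.add (ENNReal.Tendsto.const_mul (hφG.add_const _) (Or.inr ENNReal.ofReal_ne_top))
  rw [zero_add, zero_add] at hlim
  refine ge_of_tendsto' hlim fun n => ?_
  obtain ⟨hs, K, hK, hKΩ, hK0⟩ := hφ n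
  have hm := hs.continuous.aestronglyMeasurable (μ := volQ Ω T)
  have hgm := (continuous_spaceGrad hs.one_of_infty).aestronglyMeasurable (μ := volQ Ω T)
  calc eLpNorm y 2 (volQ Ω T)
      = eLpNorm (fun z => -(φ n z - y z) + φ n z) 2 (volQ Ω T) := by congr 1; funext z; ring
    _ ≤ eLpNorm (fun z => φ n z - y z) 2 (volQ Ω T) + eLpNorm (φ n) 2 (volQ Ω T) := by
        refine (eLpNorm_add_le (f := fun z => -(φ n z - y z)) (hm.sub hy.1).neg hm
          one_le_two).trans_eq ?_
        congr 1
        exact eLpNorm_neg (fun z => φ n z - y z) 2 (volQ Ω T)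
    _ ≤ _ := by
        gcongr
        refine (hC.eLpNorm_smooth_le hs hK hKΩ hK0).trans ?_
        gcongr
        calc eLpNorm (spaceGrad (φ n)) 2 (volQ Ω T)
            = eLpNorm (fun z => (spaceGrad (φ n) z - G z) + G z) 2 (volQ Ω T) := by simp
          _ ≤ _ := eLpNorm_add_le (hgm.sub hG.1) hG.1 one_le_two

theorem IsH10Zero.integral_sq_le {C : ℝ} (hC : IsFriedrichsConst Ω C) {y : Sp d × ℝ → ℝ}
    {G : Sp d × ℝ → Sp d} (h : IsH10Zero Ω T y G) :
    ∫ z, y z ^ 2 ∂(volQ Ω T) ≤ C ^ 2 * ∫ z, ‖G z‖ ^ 2 ∂(volQ Ω T) := by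
  have h1 := pow_le_pow_left₀ zero_le (h.eLpNorm_le hC) 2
  rw [mul_pow, ← h.1.ofReal_integral_norm_sq, ← h.2.1.ofReal_integral_norm_sq,
    ← ENNReal.ofReal_pow hC.1.le, ← ENNReal.ofReal_mul (by positivity),
    ENNReal.ofReal_le_ofReal_iff (mul_nonneg (by positivity)
      (integral_nonneg fun _ => by positivity))] at h1
  simpa using h1

end LateralZero

/-! ### Fourier coefficients and conjugate trigonometric sums -/

section FourierCoefficients

variable {d : ℕ} {Ω : Set (Sp d)} {T : ℝ} {E : Type*} [NormedAddCommGroup E]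

/-- The cosine coefficient of a vector valued function. -/
noncomputable def fourierCos [NormedSpace ℝ E] (T : ℝ) (f : Sp d × ℝ → E) (k : ℕ) (x : Sp d) : E :=
  (2 / T) • weightedIntegral (volume.restrict (Ioo 0 T)) (cosMode T k) f x

/-- The sine coefficient of a vector valued function. -/
noncomputable def fourierSin [NormedSpace ℝ E] (T : ℝ) (f : Sp d × ℝ → E) (k : ℕ) (x : Sp d) : E :=
  (2 / T) • weightedIntegral (volume.restrict (Ioo 0 T)) (sinMode T k) f x

/-- The conjugate of a partial sum of the Fourier series in time. -/
noncomputable def conjugateSum [InnerProductSpace ℝ E] (T : ℝ) (s : Finset ℕ) (f : Sp d × ℝ → E)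
    (z : Sp d × ℝ) : E :=
  trigPoly T s (fun k => fourierSin T f k z.1) (fun k => -fourierCos T f k z.1) z.2

theorem cosCoeff_eq_fourierCos (hT : 0 < T) (y : Sp d × ℝ → ℝ) (k : ℕ) (x : Sp d) :
    cosCoeff T y k x = fourierCos T y k x := by
  simp only [cosCoeff, fourierCos, weightedIntegral, cosMode, smul_eq_mul]
  rw [intervalIntegral.integral_of_le hT.le, integral_Ioc_eq_integral_Ioo]
  simp_rw [mul_comm (y _)]

theorem sinCoeff_eq_fourierSin (hT : 0 < T) (y : Sp d × ℝ → ℝ) (k : ℕ) (x : Sp d) :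
    sinCoeff T y k x = fourierSin T y k x := by
  simp only [sinCoeff, fourierSin, weightedIntegral, sinMode, smul_eq_mul]
  rw [intervalIntegral.integral_of_le hT.le, integral_Ioc_eq_integral_Ioo]
  simp_rw [mul_comm (y _)]

theorem integral_cosMode_smul_eq [NormedSpace ℝ E] (hT : 0 < T) (f : Sp d × ℝ → E) (x : Sp d)
    (k : ℕ) : ∫ t in Ioo 0 T, cosMode T k t • f (x, t) = (T / 2) • fourierCos T f k x := by
  rw [fourierCos, smul_smul, show T / 2 * (2 / T) = 1 by field_simp, one_smul]
  rfl

theorem integral_sinMode_smul_eq [NormedSpace ℝ E] (hT : 0 < T) (f : Sp d × ℝ → E) (x : Sp d)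
    (k : ℕ) : ∫ t in Ioo 0 T, sinMode T k t • f (x, t) = (T / 2) • fourierSin T f k x := by
  rw [fourierSin, smul_smul, show T / 2 * (2 / T) = 1 by field_simp, one_smul]
  rfl

theorem memLp_cosCoeff (hT : 0 < T) {y : Sp d × ℝ → ℝ} (hy : MemLp y 2 (volQ Ω T)) (k : ℕ) :
    MemLp (cosCoeff T y k) 2 (volume.restrict Ω) := by
  rw [volQ_eq_prod] at hy
  rw [funext (cosCoeff_eq_fourierCos hT y k)]
  exact (hy.weightedIntegral (continuous_cosMode T k).aestronglyMeasurable
    (norm_cosMode_le T k)).const_smul (2 / T)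

theorem memLp_sinCoeff (hT : 0 < T) {y : Sp d × ℝ → ℝ} (hy : MemLp y 2 (volQ Ω T)) (k : ℕ) :
    MemLp (sinCoeff T y k) 2 (volume.restrict Ω) := by
  rw [volQ_eq_prod] at hy
  rw [funext (sinCoeff_eq_fourierSin hT y k)]
  exact (hy.weightedIntegral (continuous_sinMode T k).aestronglyMeasurable
    (norm_sinMode_le T k)).const_smul (2 / T)

theorem weightedIntegral_linearCombination_ae {y₁ y₂ : Sp d × ℝ → ℝ}
    (h₁ : MemLp y₁ 2 (volQ Ω T)) (h₂ : MemLp y₂ 2 (volQ Ω T)) {a : ℝ → ℝ} (ha : Continuous a)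
    (ha1 : ∀ t, ‖a t‖ ≤ 1) (α β : ℝ) :
    ∀ᵐ x ∂(volume.restrict Ω),
      weightedIntegral (volume.restrict (Ioo 0 T)) a (fun z => α * y₁ z + β * y₂ z) x
      = α * weightedIntegral (volume.restrict (Ioo 0 T)) a y₁ x
        + β * weightedIntegral (volume.restrict (Ioo 0 T)) a y₂ x := by
  rw [volQ_eq_prod] at h₁ h₂
  filter_upwards [h₁.ae_slice, h₂.ae_slice] with x hx₁ hx₂
  unfold weightedIntegral
  rw [← integral_const_mul, ← integral_const_mul, ← integral_add
    ((integrable_bdd_smul ha ha1 (hx₁.integrable one_le_two)).const_mul α)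
    ((integrable_bdd_smul ha ha1 (hx₂.integrable one_le_two)).const_mul β)]
  refine integral_congr_ae (ae_of_all _ fun t => ?_)
  simp only [smul_eq_mul]
  ring

theorem cosCoeff_linearCombination_ae (hT : 0 < T) {y₁ y₂ : Sp d × ℝ → ℝ}
    (h₁ : MemLp y₁ 2 (volQ Ω T)) (h₂ : MemLp y₂ 2 (volQ Ω T)) (α β : ℝ) (k : ℕ) :
    ∀ᵐ x ∂(volume.restrict Ω), cosCoeff T (fun z => α * y₁ z + β * y₂ z) k x
      = α * cosCoeff T y₁ k x + β * cosCoeff T y₂ k x := by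
  filter_upwards [weightedIntegral_linearCombination_ae h₁ h₂ (continuous_cosMode T k)
    (norm_cosMode_le T k) α β] with x hx
  simp only [cosCoeff_eq_fourierCos hT, fourierCos, hx, smul_eq_mul]
  ring

theorem sinCoeff_linearCombination_ae (hT : 0 < T) {y₁ y₂ : Sp d × ℝ → ℝ}
    (h₁ : MemLp y₁ 2 (volQ Ω T)) (h₂ : MemLp y₂ 2 (volQ Ω T)) (α β : ℝ) (k : ℕ) :
    ∀ᵐ x ∂(volume.restrict Ω), sinCoeff T (fun z => α * y₁ z + β * y₂ z) k x
      = α * sinCoeff T y₁ k x + β * sinCoeff T y₂ k x := by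
  filter_upwards [weightedIntegral_linearCombination_ae h₁ h₂ (continuous_sinMode T k)
    (norm_sinMode_le T k) α β] with x hx
  simp only [sinCoeff_eq_fourierSin hT, fourierSin, hx, smul_eq_mul]
  ring

/-- With its sine counterpart: on `s` the coefficient pair of the conjugate sum p is (y^s, -y^c), so
p_k^⊥ = y_k. This turns the half-order form into a square. -/
theorem cosCoeff_conjugateSum (hT : 0 < T) {s : Finset ℕ} (hs : 0 ∉ s) (y : Sp d × ℝ → ℝ)
    (k : ℕ) (x : Sp d) :
    cosCoeff T (conjugateSum T s y) k x = if k ∈ s then sinCoeff T y k x else 0 := by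
  rw [cosCoeff_eq_fourierCos hT, sinCoeff_eq_fourierSin hT, fourierCos, weightedIntegral]
  simp only [conjugateSum]
  rw [integral_cosMode_smul_trigPoly hT hs, smul_smul, show 2 / T * (T / 2) = 1 by field_simp,
    one_smul]

theorem sinCoeff_conjugateSum (hT : 0 < T) {s : Finset ℕ} (hs : 0 ∉ s) (y : Sp d × ℝ → ℝ)
    (k : ℕ) (x : Sp d) :
    sinCoeff T (conjugateSum T s y) k x = if k ∈ s then -cosCoeff T y k x else 0 := by
  rw [sinCoeff_eq_fourierSin hT, cosCoeff_eq_fourierCos hT, fourierSin, weightedIntegral]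
  simp only [conjugateSum]
  rw [integral_sinMode_smul_trigPoly hT hs, smul_smul, show 2 / T * (T / 2) = 1 by field_simp,
    one_smul]

theorem IsH10Zero.conjugateSum {y : Sp d × ℝ → ℝ} {G : Sp d × ℝ → Sp d}
    (h : IsH10Zero Ω T y G) (s : Finset ℕ) :
    IsH10Zero Ω T (conjugateSum T s y) (conjugateSum T s G) := by
  have h1 := IsH10Zero.sum s fun k =>
    (h.modulate (contDiff_sinMode T k) (contDiff_cosMode T k) (norm_sinMode_le T k)
      (norm_cosMode_le T k)).linearCombination (h.modulate (contDiff_cosMode T k)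
        (contDiff_sinMode T k) (norm_cosMode_le T k) (norm_sinMode_le T k)) (2 / T) (-(2 / T))
  convert h1 using 1
  · funext z
    refine Finset.sum_congr rfl fun k _ => ?_
    simp only [fourierCos, fourierSin, smul_eq_mul]
    ring
  · funext z
    refine Finset.sum_congr rfl fun k _ => ?_
    simp only [fourierCos, fourierSin]
    module

/-- For fixed x the coefficient is constant in time and factors out; conjugate modes are orthogonal
on each such line. -/
theorem integral_mul_inner_conjugateSum (hT : 0 < T) {ν : Sp d → ℝ} {C : ℝ}
    (hνm : AEStronglyMeasurable ν (volume.restrict Ω)) (hν : ∀ᵐ x ∂(volume.restrict Ω), ‖ν x‖ ≤ C)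
    {G : Sp d × ℝ → Sp d} {s : Finset ℕ} (hG : MemLp G 2 (volQ Ω T))
    (hP : MemLp (conjugateSum T s G) 2 (volQ Ω T)) :
    ∫ z, ν z.1 * inner ℝ (G z) (conjugateSum T s G z) ∂(volQ Ω T) = 0 := by
  have hi := hG.integrable_inner hP
  rw [volQ_eq_prod] at *
  have hi2 : Integrable (fun z => ν z.1 * inner ℝ (G z) (conjugateSum T s G z))
      ((volume.restrict Ω).prod (volume.restrict (Ioo 0 T))) :=
    hi.bdd_mul hνm.comp_fst (Measure.quasiMeasurePreserving_fst.ae hν)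
  rw [integral_prod _ hi2]
  refine integral_eq_zero_of_ae ?_
  filter_upwards [hG.ae_slice] with x hx
  rw [integral_const_mul]
  have h := integral_inner_conjugate_trigPoly (hx.integrable one_le_two) s
    (integral_cosMode_smul_eq hT G x) (integral_sinMode_smul_eq hT G x)
  simp only [conjugateSum, h, mul_zero, Pi.zero_apply]

theorem integral_norm_sq_conjugateSum_le (hT : 0 < T) {G : Sp d × ℝ → Sp d} {s : Finset ℕ}
    (hs : 0 ∉ s) (hG : MemLp G 2 (volQ Ω T)) (hP : MemLp (conjugateSum T s G) 2 (volQ Ω T)) :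
    ∫ z, ‖conjugateSum T s G z‖ ^ 2 ∂(volQ Ω T) ≤ ∫ z, ‖G z‖ ^ 2 ∂(volQ Ω T) := by
  rw [volQ_eq_prod] at *
  have hGi := (memLp_two_iff_integrable_sq_norm hG.1).1 hG
  have hPi := (memLp_two_iff_integrable_sq_norm hP.1).1 hP
  rw [integral_prod _ hGi, integral_prod _ hPi]
  have h : ∀ᵐ x ∂(volume.restrict Ω), ∫ t in Ioo 0 T, ‖conjugateSum T s G (x, t)‖ ^ 2
      ≤ ∫ t in Ioo 0 T, ‖G (x, t)‖ ^ 2 := by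
    filter_upwards [hG.ae_slice] with x hx
    have := integral_norm_sq_conjugate_trigPoly_le hT hs hx (integral_cosMode_smul_eq hT G x)
      (integral_sinMode_smul_eq hT G x)
    simpa only [conjugateSum] using this
  exact integral_mono_ae hPi.integral_prod_left hGi.integral_prod_left h

end FourierCoefficients

/-! ### The half-order terms -/

section HalfOrder

variable {d : ℕ} {Ω : Set (Sp d)} {T : ℝ} {σ : Sp d → ℝ} {C : ℝ}

theorem freq_pos (hT : 0 < T) : 0 < freq T := div_pos Real.two_pi_pos hT

theorem halfTerm_nonneg (hT : 0 < T) (y : Sp d × ℝ → ℝ) (k : ℕ) : 0 ≤ halfTerm Ω T y k :=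
  mul_nonneg (mul_nonneg k.cast_nonneg (freq_pos hT).le) (integral_nonneg fun _ => by positivity)

theorem integrable_coeff_sq (hT : 0 < T) {y : Sp d × ℝ → ℝ} (hy : MemLp y 2 (volQ Ω T)) (k : ℕ) :
    Integrable (fun x => cosCoeff T y k x ^ 2 + sinCoeff T y k x ^ 2) (volume.restrict Ω) :=
  (memLp_cosCoeff hT hy k).integrable_sq.add (memLp_sinCoeff hT hy k).integrable_sq

theorem integrable_halfForm_term (hT : 0 < T) (hσm : AEStronglyMeasurable σ (volume.restrict Ω))
    (hσ : ∀ᵐ x ∂(volume.restrict Ω), ‖σ x‖ ≤ C) {y q : Sp d × ℝ → ℝ}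
    (hy : MemLp y 2 (volQ Ω T)) (hq : MemLp q 2 (volQ Ω T)) (k : ℕ) :
    Integrable (fun x => σ x * (cosCoeff T y k x * (-sinCoeff T q k x)
      + sinCoeff T y k x * cosCoeff T q k x)) (volume.restrict Ω) :=
  (((memLp_cosCoeff hT hy k).integrable_mul (memLp_sinCoeff hT hq k).neg).add
    ((memLp_sinCoeff hT hy k).integrable_mul (memLp_cosCoeff hT hq k))).bdd_mul hσm hσ

theorem abs_halfForm_term_le (hT : 0 < T)
    (hσ : ∀ᵐ x ∂(volume.restrict Ω), ‖σ x‖ ≤ C) {y q : Sp d × ℝ → ℝ}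
    (hy : MemLp y 2 (volQ Ω T)) (hq : MemLp q 2 (volQ Ω T)) (k : ℕ) :
    ‖k * freq T * ∫ x in Ω, σ x * (cosCoeff T y k x * (-sinCoeff T q k x)
      + sinCoeff T y k x * cosCoeff T q k x)‖ ≤ C * (halfTerm Ω T y k + halfTerm Ω T q k) := by
  have hk : 0 ≤ k * freq T := mul_nonneg k.cast_nonneg (freq_pos hT).le
  have h : ‖∫ x in Ω, σ x * (cosCoeff T y k x * (-sinCoeff T q k x)
      + sinCoeff T y k x * cosCoeff T q k x)‖
      ≤ ∫ x in Ω, C * ((cosCoeff T y k x ^ 2 + sinCoeff T y k x ^ 2)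
        + (cosCoeff T q k x ^ 2 + sinCoeff T q k x ^ 2)) := by
    refine norm_integral_le_of_norm_le
      (((integrable_coeff_sq hT hy k).add (integrable_coeff_sq hT hq k)).const_mul C) ?_
    filter_upwards [hσ] with x hx
    rw [norm_mul]
    refine mul_le_mul hx ?_ (norm_nonneg _) ((norm_nonneg _).trans hx)
    rw [Real.norm_eq_abs, abs_le]
    constructor <;>
    nlinarith [sq_nonneg (cosCoeff T y k x - sinCoeff T q k x),
      sq_nonneg (cosCoeff T y k x + sinCoeff T q k x),
      sq_nonneg (sinCoeff T y k x - cosCoeff T q k x),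
      sq_nonneg (sinCoeff T y k x + cosCoeff T q k x)]
  rw [integral_const_mul, integral_add (integrable_coeff_sq hT hy k)
    (integrable_coeff_sq hT hq k)] at h
  rw [norm_mul, Real.norm_of_nonneg hk]
  refine (mul_le_mul_of_nonneg_left h hk).trans_eq ?_
  unfold halfTerm
  ring

/-- Needed for linearity of `halfForm`: the sum of a non-summable series defaults to 0, and
additivity would fail. -/
theorem summable_halfForm (hT : 0 < T)
    (hσ : ∀ᵐ x ∂(volume.restrict Ω), ‖σ x‖ ≤ C) {y q : Sp d × ℝ → ℝ}
    (hy : MemLp y 2 (volQ Ω T)) (hq : MemLp q 2 (volQ Ω T)) (hys : Summable (halfTerm Ω T y))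
    (hqs : Summable (halfTerm Ω T q)) :
    Summable fun k : ℕ => k * freq T * ∫ x in Ω, σ x * (cosCoeff T y k x * (-sinCoeff T q k x)
      + sinCoeff T y k x * cosCoeff T q k x) :=
  Summable.of_norm_bounded ((hys.add hqs).mul_left C) fun k => abs_halfForm_term_le hT hσ hy hq k

theorem halfForm_linearCombination (hT : 0 < T)
    (hσm : AEStronglyMeasurable σ (volume.restrict Ω))
    (hσ : ∀ᵐ x ∂(volume.restrict Ω), ‖σ x‖ ≤ C) {y₁ y₂ q : Sp d × ℝ → ℝ}
    (h₁ : MemLp y₁ 2 (volQ Ω T)) (h₂ : MemLp y₂ 2 (volQ Ω T)) (hq : MemLp q 2 (volQ Ω T))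
    (hs₁ : Summable (halfTerm Ω T y₁)) (hs₂ : Summable (halfTerm Ω T y₂))
    (hsq : Summable (halfTerm Ω T q)) (α β : ℝ) :
    halfForm Ω T σ (fun z => α * y₁ z + β * y₂ z) q
      = α * halfForm Ω T σ y₁ q + β * halfForm Ω T σ y₂ q := by
  have hterm : ∀ k : ℕ, k * freq T * ∫ x in Ω, σ x *
      (cosCoeff T (fun z => α * y₁ z + β * y₂ z) k x * (-sinCoeff T q k x)
        + sinCoeff T (fun z => α * y₁ z + β * y₂ z) k x * cosCoeff T q k x)
      = α * (k * freq T * ∫ x in Ω, σ x * (cosCoeff T y₁ k x * (-sinCoeff T q k x)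
          + sinCoeff T y₁ k x * cosCoeff T q k x))
        + β * (k * freq T * ∫ x in Ω, σ x * (cosCoeff T y₂ k x * (-sinCoeff T q k x)
          + sinCoeff T y₂ k x * cosCoeff T q k x)) := by
    intro k
    have h : ∫ x in Ω, σ x *
        (cosCoeff T (fun z => α * y₁ z + β * y₂ z) k x * (-sinCoeff T q k x)
          + sinCoeff T (fun z => α * y₁ z + β * y₂ z) k x * cosCoeff T q k x)
        = ∫ x in Ω, (α * (σ x * (cosCoeff T y₁ k x * (-sinCoeff T q k x)
            + sinCoeff T y₁ k x * cosCoeff T q k x))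
          + β * (σ x * (cosCoeff T y₂ k x * (-sinCoeff T q k x)
            + sinCoeff T y₂ k x * cosCoeff T q k x))) := by
      refine integral_congr_ae ?_
      filter_upwards [cosCoeff_linearCombination_ae hT h₁ h₂ α β k,
        sinCoeff_linearCombination_ae hT h₁ h₂ α β k] with x hc hs
      rw [hc, hs]
      ring
    rw [h, integral_add ((integrable_halfForm_term hT hσm hσ h₁ hq k).const_mul α)
      ((integrable_halfForm_term hT hσm hσ h₂ hq k).const_mul β), integral_const_mul,
      integral_const_mul]
    ring
  unfold halfForm
  simp_rw [hterm]
  rw [((summable_halfForm hT hσ h₁ hq hs₁ hsq).mul_left α).tsum_add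
    ((summable_halfForm hT hσ h₂ hq hs₂ hsq).mul_left β), tsum_mul_left, tsum_mul_left]
  ring

theorem summable_halfTerm_linearCombination (hT : 0 < T) {y₁ y₂ : Sp d × ℝ → ℝ}
    (h₁ : MemLp y₁ 2 (volQ Ω T)) (h₂ : MemLp y₂ 2 (volQ Ω T))
    (hs₁ : Summable (halfTerm Ω T y₁)) (hs₂ : Summable (halfTerm Ω T y₂)) (α β : ℝ) :
    Summable (halfTerm Ω T fun z => α * y₁ z + β * y₂ z) := by
  refine Summable.of_nonneg_of_le (halfTerm_nonneg hT _) (fun k => ?_)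
    ((hs₁.mul_left (2 * α ^ 2)).add (hs₂.mul_left (2 * β ^ 2)))
  have hk : 0 ≤ k * freq T := mul_nonneg k.cast_nonneg (freq_pos hT).le
  have h : ∫ x in Ω, (cosCoeff T (fun z => α * y₁ z + β * y₂ z) k x ^ 2
      + sinCoeff T (fun z => α * y₁ z + β * y₂ z) k x ^ 2)
      ≤ ∫ x in Ω, (2 * α ^ 2 * (cosCoeff T y₁ k x ^ 2 + sinCoeff T y₁ k x ^ 2)
        + 2 * β ^ 2 * (cosCoeff T y₂ k x ^ 2 + sinCoeff T y₂ k x ^ 2)) := by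
    refine integral_mono_ae (integrable_coeff_sq hT ((h₁.const_mul α).add (h₂.const_mul β)) k)
      (((integrable_coeff_sq hT h₁ k).const_mul _).add
        ((integrable_coeff_sq hT h₂ k).const_mul _)) ?_
    filter_upwards [cosCoeff_linearCombination_ae hT h₁ h₂ α β k,
      sinCoeff_linearCombination_ae hT h₁ h₂ α β k] with x hc hs
    rw [hc, hs]
    nlinarith [sq_nonneg (α * cosCoeff T y₁ k x - β * cosCoeff T y₂ k x),
      sq_nonneg (α * sinCoeff T y₁ k x - β * sinCoeff T y₂ k x)]
  rw [integral_add ((integrable_coeff_sq hT h₁ k).const_mul _)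
    ((integrable_coeff_sq hT h₂ k).const_mul _), integral_const_mul, integral_const_mul] at h
  refine (mul_le_mul_of_nonneg_left h hk).trans_eq ?_
  unfold halfTerm
  ring

theorem IsH1HalfZeroPer.linearCombination (hT : 0 < T) {y₁ y₂ : Sp d × ℝ → ℝ}
    {G₁ G₂ : Sp d × ℝ → Sp d} (h₁ : IsH1HalfZeroPer Ω T y₁ G₁) (h₂ : IsH1HalfZeroPer Ω T y₂ G₂)
    (α β : ℝ) :
    IsH1HalfZeroPer Ω T (fun z => α * y₁ z + β * y₂ z) (fun z => α • G₁ z + β • G₂ z) :=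
  ⟨h₁.1.linearCombination h₂.1 α β,
    summable_halfTerm_linearCombination hT h₁.1.1 h₂.1.1 h₁.2 h₂.2 α β⟩

/-- Only the modes in `s` survive, so the half-order series is a finite sum whatever the time
regularity of `y`. -/
theorem IsH10Zero.isH1HalfZeroPer_conjugateSum (hT : 0 < T) {y : Sp d × ℝ → ℝ}
    {G : Sp d × ℝ → Sp d} (h : IsH10Zero Ω T y G) {s : Finset ℕ} (hs : 0 ∉ s) :
    IsH1HalfZeroPer Ω T (_root_.conjugateSum T s y) (_root_.conjugateSum T s G) := by
  refine ⟨h.conjugateSum s, summable_of_ne_finset_zero (s := s) fun k hk => ?_⟩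
  simp [halfTerm, cosCoeff_conjugateSum hT hs, sinCoeff_conjugateSum hT hs, hk]

/-- Pointwise, y_k is orthogonal to y_k^⊥. -/
theorem halfForm_self (y : Sp d × ℝ → ℝ) : halfForm Ω T σ y y = 0 := by
  simp [halfForm, mul_comm]

theorem halfForm_conjugateSum (hT : 0 < T) {s : Finset ℕ} (hs : 0 ∉ s) (y : Sp d × ℝ → ℝ) :
    halfForm Ω T σ y (conjugateSum T s y) = T / 2 * ∑ k ∈ s, k * freq T *
      ∫ x in Ω, σ x * (cosCoeff T y k x ^ 2 + sinCoeff T y k x ^ 2) := by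
  unfold halfForm
  congr 1
  rw [tsum_eq_sum (s := s) fun k hk => by
    simp [cosCoeff_conjugateSum hT hs, sinCoeff_conjugateSum hT hs, hk]]
  refine Finset.sum_congr rfl fun k hk => ?_
  simp [cosCoeff_conjugateSum hT hs, sinCoeff_conjugateSum hT hs, hk, sq]

theorem le_halfForm_conjugateSum (hT : 0 < T) {σlow : ℝ}
    (hσm : AEStronglyMeasurable σ (volume.restrict Ω))
    (hσ : ∀ᵐ x ∂(volume.restrict Ω), ‖σ x‖ ≤ C)
    (hσlow : ∀ᵐ x ∂(volume.restrict Ω), σlow ≤ σ x) {s : Finset ℕ} (hs : 0 ∉ s)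
    {y : Sp d × ℝ → ℝ} (hy : MemLp y 2 (volQ Ω T)) :
    σlow * (T / 2 * ∑ k ∈ s, halfTerm Ω T y k) ≤ halfForm Ω T σ y (conjugateSum T s y) := by
  rw [halfForm_conjugateSum hT hs, mul_left_comm, Finset.mul_sum]
  refine mul_le_mul_of_nonneg_left (Finset.sum_le_sum fun k _ => ?_) (by positivity)
  have hk : 0 ≤ k * freq T := mul_nonneg k.cast_nonneg (freq_pos hT).le
  rw [halfTerm, mul_left_comm, ← integral_const_mul]
  refine mul_le_mul_of_nonneg_left (integral_mono_ae ((integrable_coeff_sq hT hy k).const_mul _)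
    ((integrable_coeff_sq hT hy k).bdd_mul hσm hσ) ?_) hk
  filter_upwards [hσlow] with x hx
  exact mul_le_mul_of_nonneg_right hx (by positivity)

end HalfOrder

/-! ### Stability of the state in the seminorm -/

section States

variable {d : ℕ} {Ω : Set (Sp d)} {T : ℝ} {σ ν : Sp d → ℝ} {Cσ Cν : ℝ}

theorem integrable_coeff_mul_inner (hνm : AEStronglyMeasurable ν (volume.restrict Ω))
    (hν : ∀ᵐ x ∂(volume.restrict Ω), ‖ν x‖ ≤ Cν) {G₁ G₂ : Sp d × ℝ → Sp d}
    (h₁ : MemLp G₁ 2 (volQ Ω T)) (h₂ : MemLp G₂ 2 (volQ Ω T)) :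
    Integrable (fun z => ν z.1 * inner ℝ (G₁ z) (G₂ z)) (volQ Ω T) := by
  have hi := h₁.integrable_inner h₂
  rw [volQ_eq_prod] at *
  exact hi.bdd_mul hνm.comp_fst (Measure.quasiMeasurePreserving_fst.ae hν)

theorem IsState.linearCombination (hT : 0 < T)
    (hσm : AEStronglyMeasurable σ (volume.restrict Ω))
    (hνm : AEStronglyMeasurable ν (volume.restrict Ω))
    (hσ : ∀ᵐ x ∂(volume.restrict Ω), ‖σ x‖ ≤ Cσ) (hν : ∀ᵐ x ∂(volume.restrict Ω), ‖ν x‖ ≤ Cν)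
    {v₁ v₂ y₁ y₂ : Sp d × ℝ → ℝ} {G₁ G₂ : Sp d × ℝ → Sp d}
    (hv₁ : MemLp v₁ 2 (volQ Ω T)) (hv₂ : MemLp v₂ 2 (volQ Ω T))
    (h₁ : IsState Ω T σ ν v₁ y₁ G₁) (h₂ : IsState Ω T σ ν v₂ y₂ G₂) (α β : ℝ) :
    IsState Ω T σ ν (fun z => α * v₁ z + β * v₂ z) (fun z => α * y₁ z + β * y₂ z)
      (fun z => α • G₁ z + β • G₂ z) := by
  refine ⟨h₁.1.linearCombination hT h₂.1 α β, fun q Gq hq => ?_⟩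
  have hq2 := hq.1.1
  have e₁ := h₁.2 q Gq hq
  have e₂ := h₂.2 q Gq hq
  have i₁ := integrable_coeff_mul_inner hνm hν h₁.1.1.2.1 hq.1.2.1
  have i₂ := integrable_coeff_mul_inner hνm hν h₂.1.1.2.1 hq.1.2.1
  have j₁ : Integrable (fun z => v₁ z * q z) (volQ Ω T) := hv₁.integrable_mul hq2
  have j₂ : Integrable (fun z => v₂ z * q z) (volQ Ω T) := hv₂.integrable_mul hq2
  rw [halfForm_linearCombination hT hσm hσ h₁.1.1.1 h₂.1.1.1 hq2 h₁.1.2 h₂.1.2 hq.2]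
  have l : ∫ z, ν z.1 * inner ℝ (α • G₁ z + β • G₂ z) (Gq z) ∂(volQ Ω T)
      = α * ∫ z, ν z.1 * inner ℝ (G₁ z) (Gq z) ∂(volQ Ω T)
        + β * ∫ z, ν z.1 * inner ℝ (G₂ z) (Gq z) ∂(volQ Ω T) := by
    rw [← integral_const_mul, ← integral_const_mul,
      ← integral_add (i₁.const_mul α) (i₂.const_mul β)]
    refine integral_congr_ae (ae_of_all _ fun z => ?_)
    simp only [inner_add_left, real_inner_smul_left]
    ring
  have r : ∫ z, (α * v₁ z + β * v₂ z) * q z ∂(volQ Ω T)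
      = α * ∫ z, v₁ z * q z ∂(volQ Ω T) + β * ∫ z, v₂ z * q z ∂(volQ Ω T) := by
    rw [← integral_const_mul, ← integral_const_mul,
      ← integral_add (j₁.const_mul α) (j₂.const_mul β)]
    refine integral_congr_ae (ae_of_all _ fun z => ?_)
    ring
  rw [l, r, ← e₁, ← e₂]
  ring

variable {σlow νlow CF : ℝ}

theorem integral_norm_sq_add_conjugateSum_le (hT : 0 < T) {G : Sp d × ℝ → Sp d}
    {s : Finset ℕ} (hs : 0 ∉ s) (hG : MemLp G 2 (volQ Ω T))
    (hP : MemLp (conjugateSum T s G) 2 (volQ Ω T)) :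
    ∫ z, ‖G z + conjugateSum T s G z‖ ^ 2 ∂(volQ Ω T) ≤ 2 * ∫ z, ‖G z‖ ^ 2 ∂(volQ Ω T) := by
  -- The weight 1 gives plain orthogonality; Bessel bounds the remaining square by that of `G`,
  -- whence the factor 2.
  have hcross := integral_mul_inner_conjugateSum (ν := fun _ => 1) (C := 1) hT
    aestronglyMeasurable_const (ae_of_all _ fun _ => by simp) hG hP
  simp only [one_mul] at hcross
  have hGi := (memLp_two_iff_integrable_sq_norm hG.1).1 hG
  have hPi := (memLp_two_iff_integrable_sq_norm hP.1).1 hP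
  have hi := (hG.integrable_inner hP).const_mul 2
  have hGi' : Integrable (fun z => ‖G z‖ ^ 2 + 2 * inner ℝ (G z) (conjugateSum T s G z))
    (volQ Ω T) := hGi.add hi
  simp_rw [norm_add_sq_real]
  rw [integral_add hGi' hPi, integral_add hGi hi, integral_const_mul, hcross]
  linarith [integral_norm_sq_conjugateSum_le hT hs hG hP]

/-- Write A for ‖∇y‖², B for the partial half-order sum, m for min(ν_low, σ_low). Testing with y and
with p gives m(A + B) ≤ ∫w(y+p), and half of mA is absorbed after Young and Friedrichs. -/
theorem IsState.partial_seminormSq_le (hT : 0 < T)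
    (hσm : AEStronglyMeasurable σ (volume.restrict Ω))
    (hνm : AEStronglyMeasurable ν (volume.restrict Ω))
    (hσ : ∀ᵐ x ∂(volume.restrict Ω), ‖σ x‖ ≤ Cσ) (hν : ∀ᵐ x ∂(volume.restrict Ω), ‖ν x‖ ≤ Cν)
    (hσlow0 : 0 < σlow) (hνlow0 : 0 < νlow) (hσlow : ∀ᵐ x ∂(volume.restrict Ω), σlow ≤ σ x)
    (hνlow : ∀ᵐ x ∂(volume.restrict Ω), νlow ≤ ν x) (hCF : IsFriedrichsConst Ω CF)
    {w y : Sp d × ℝ → ℝ} {G : Sp d × ℝ → Sp d} (hw : MemLp w 2 (volQ Ω T))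
    (h : IsState Ω T σ ν w y G) {s : Finset ℕ} (hs : 0 ∉ s) :
    muOne νlow σlow ^ 2 * (∫ z, ‖G z‖ ^ 2 ∂(volQ Ω T) + T / 2 * ∑ k ∈ s, halfTerm Ω T y k)
      ≤ CF ^ 2 * ∫ z, w z ^ 2 ∂(volQ Ω T) := by
  have hy := h.1.1.1
  have hG := h.1.1.2.1
  have hp := h.1.1.isH1HalfZeroPer_conjugateSum hT hs
  have hP := hp.1.2.1
  have hCF0 := hCF.1
  have hGi := (memLp_two_iff_integrable_sq_norm hG.1).1 hG
  have testy := h.2 y G h.1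
  rw [halfForm_self, add_zero] at testy
  have testp := h.2 _ _ hp
  rw [integral_mul_inner_conjugateSum hT hνm hν hG hP, zero_add] at testp
  have lowy : νlow * ∫ z, ‖G z‖ ^ 2 ∂(volQ Ω T) ≤ ∫ z, w z * y z ∂(volQ Ω T) := by
    rw [← testy, ← integral_const_mul]
    refine integral_mono_ae (hGi.const_mul _) (integrable_coeff_mul_inner hνm hν hG hG) ?_
    rw [volQ_eq_prod]
    filter_upwards [Measure.quasiMeasurePreserving_fst.ae hνlow] with z hz
    rw [real_inner_self_eq_norm_sq]
    exact mul_le_mul_of_nonneg_right hz (by positivity)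
  have lowp := le_halfForm_conjugateSum hT hσm hσ hσlow hs hy
  rw [testp] at lowp
  have hq := h.1.1.linearCombination hp.1 1 1
  simp only [one_mul, one_smul] at hq
  have fq := hq.integral_sq_le hCF
  have gq := integral_norm_sq_add_conjugateSum_le hT hs hG hP
  have iwy : Integrable (fun z => w z * y z) (volQ Ω T) := hw.integrable_mul hy
  have iwp : Integrable (fun z => w z * conjugateSum T s y z) (volQ Ω T) :=
    hw.integrable_mul hp.1.1
  set m := min νlow σlow with hm
  have hm0 : 0 < m := lt_min hνlow0 hσlow0
  -- The Young weight m/(4C_F²) is chosen so that, with ‖y+p‖² ≤ 2C_F²A, the last term becomes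
  -- exactly mA/2.
  have young : ∫ z, w z * y z ∂(volQ Ω T) + ∫ z, w z * conjugateSum T s y z ∂(volQ Ω T)
      ≤ CF ^ 2 / m * ∫ z, w z ^ 2 ∂(volQ Ω T)
        + m / (4 * CF ^ 2) * ∫ z, (y z + conjugateSum T s y z) ^ 2 ∂(volQ Ω T) := by
    rw [← integral_add iwy iwp, ← integral_const_mul, ← integral_const_mul,
      ← integral_add (hw.integrable_sq.const_mul _) (hq.1.integrable_sq.const_mul _)]
    refine integral_mono (iwy.add iwp) ((hw.integrable_sq.const_mul _).add
      (hq.1.integrable_sq.const_mul _)) fun z => ?_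
    simp only [← mul_add]
    generalize y z + conjugateSum T s y z = b
    have key : CF ^ 2 / m * w z ^ 2 + m / (4 * CF ^ 2) * b ^ 2 - w z * b
        = (2 * CF ^ 2 * w z - m * b) ^ 2 / (4 * CF ^ 2 * m) := by
      field_simp
      ring
    have : 0 ≤ (2 * CF ^ 2 * w z - m * b) ^ 2 / (4 * CF ^ 2 * m) := by positivity
    linarith
  set A := ∫ z, ‖G z‖ ^ 2 ∂(volQ Ω T)
  set B := T / 2 * ∑ k ∈ s, halfTerm Ω T y k
  have hA : 0 ≤ A := integral_nonneg fun _ => by positivity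
  have hB : 0 ≤ B := mul_nonneg (by positivity)
    (Finset.sum_nonneg fun k _ => halfTerm_nonneg hT y k)
  have b1 : m * A ≤ νlow * A := mul_le_mul_of_nonneg_right (min_le_left _ _) hA
  have b2 : m * B ≤ σlow * B := mul_le_mul_of_nonneg_right (min_le_right _ _) hB
  have b3 : m / (4 * CF ^ 2) * ∫ z, (y z + conjugateSum T s y z) ^ 2 ∂(volQ Ω T)
      ≤ m / 2 * A := by
    calc _ ≤ m / (4 * CF ^ 2) * (CF ^ 2 * (2 * A)) := by
          refine mul_le_mul_of_nonneg_left (fq.trans ?_) (by positivity)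
          exact mul_le_mul_of_nonneg_left gq (by positivity)
      _ = _ := by field_simp; ring
  -- Absorption leaves mA/2 + mB; half of mB is discarded to give both parts the same constant.
  have b4 : m / 2 * (A + B) ≤ CF ^ 2 / m * ∫ z, w z ^ 2 ∂(volQ Ω T) := by
    nlinarith [mul_nonneg hm0.le hB]
  have b5 := mul_le_mul_of_nonneg_left b4 hm0.le
  -- One factor m undoes the division in Young's inequality, the factor m/2 is what survives
  -- absorption; this explains the 1/√2 in μ₁.
  have hmu : muOne νlow σlow ^ 2 = m * (m / 2) := by
    rw [muOne, mul_pow, div_pow, Real.sq_sqrt (by norm_num), ← hm]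
    ring
  rw [hmu, mul_assoc]
  refine b5.trans_eq ?_
  field_simp

/-- The inf-sup stability `μ₁ |y(w)|_{1,1/2} ≤ C_F ‖w‖` of the state, with test functions
`y + p`, where `p` is a conjugate partial Fourier sum of `y`. -/
theorem IsState.seminormSq_le (hT : 0 < T)
    (hσm : AEStronglyMeasurable σ (volume.restrict Ω))
    (hνm : AEStronglyMeasurable ν (volume.restrict Ω))
    (hσ : ∀ᵐ x ∂(volume.restrict Ω), ‖σ x‖ ≤ Cσ) (hν : ∀ᵐ x ∂(volume.restrict Ω), ‖ν x‖ ≤ Cν)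
    (hσlow0 : 0 < σlow) (hνlow0 : 0 < νlow) (hσlow : ∀ᵐ x ∂(volume.restrict Ω), σlow ≤ σ x)
    (hνlow : ∀ᵐ x ∂(volume.restrict Ω), νlow ≤ ν x) (hCF : IsFriedrichsConst Ω CF)
    {w y : Sp d × ℝ → ℝ} {G : Sp d × ℝ → Sp d} (hw : MemLp w 2 (volQ Ω T))
    (h : IsState Ω T σ ν w y G) :
    muOne νlow σlow ^ 2 * seminormSq Ω T y G ≤ CF ^ 2 * ∫ z, w z ^ 2 ∂(volQ Ω T) := by
  have hμ : 0 < muOne νlow σlow ^ 2 := by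
    have : 0 < min νlow σlow := lt_min hνlow0 hσlow0
    unfold muOne
    positivity
  have hlim : Tendsto (fun s : Finset ℕ => muOne νlow σlow ^ 2 *
      (∫ z, ‖G z‖ ^ 2 ∂(volQ Ω T) + T / 2 * ∑ k ∈ s, halfTerm Ω T y k)) atTop
      (𝓝 (muOne νlow σlow ^ 2 * seminormSq Ω T y G)) :=
    ((h.1.2.hasSum.const_mul (T / 2)).const_add _).const_mul _
  refine le_of_tendsto' hlim fun s => ?_
  -- The mode 0 carries the weight k = 0, so removing it costs nothing and makes the conjugation
  -- formulas available.
  have h0 : ∑ k ∈ s, halfTerm Ω T y k = ∑ k ∈ s.erase 0, halfTerm Ω T y k :=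
    (Finset.sum_erase s (by simp [halfTerm])).symm
  rw [h0]
  exact h.partial_seminormSq_le hT hσm hνm hσ hν hσlow0 hνlow0 hσlow hνlow hCF hw
    (Finset.notMem_erase 0 s)

end States

/-! ### Quadratic expansion of the cost functional -/

section Cost

variable {d : ℕ} {Ω : Set (Sp d)} {T : ℝ}

/-- Used with h = y_d for the tracking term and with h = 0 for the control term. -/
theorem integral_sq_segment {X : Type*} [MeasurableSpace X] {μ : Measure X} {f g h : X → ℝ}
    (hf : MemLp f 2 μ) (hg : MemLp g 2 μ) (hh : MemLp h 2 μ) (θ : ℝ) :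
    ∫ x, ((1 - θ) * f x + θ * g x - h x) ^ 2 ∂μ = ∫ x, (f x - h x) ^ 2 ∂μ
      + θ * (2 * ∫ x, (f x - h x) * (g x - f x) ∂μ) + θ ^ 2 * ∫ x, (f x - g x) ^ 2 ∂μ := by
  have i1 : Integrable (fun x => (f x - h x) ^ 2) μ := (hf.sub hh).integrable_sq
  have i2 : Integrable (fun x => (f x - h x) * (g x - f x)) μ :=
    (hf.sub hh).integrable_mul (hg.sub hf)
  have i3 : Integrable (fun x => (f x - g x) ^ 2) μ := (hf.sub hg).integrable_sq
  rw [← mul_assoc, ← integral_const_mul, ← integral_const_mul,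
    ← integral_add i1 (i2.const_mul _)]
  rw [← integral_add (f := fun x => (f x - h x) ^ 2 + θ * 2 * ((f x - h x) * (g x - f x)))
    (i1.add (i2.const_mul _)) (i3.const_mul _)]
  refine integral_congr_ae (ae_of_all _ fun x => ?_)
  ring

/-- The polynomial has no constant term, so its discriminant is b², and nonnegativity forces b² ≤ 0.
-/
theorem eq_zero_of_quadratic_nonneg {a b : ℝ} (h : ∀ θ : ℝ, 0 ≤ θ * b + θ ^ 2 * a) : b = 0 := by
  have h1 := discrim_le_zero (a := a) (b := b) (c := 0) fun x => by
    have := h x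
    linarith
  rw [discrim] at h1
  nlinarith [sq_nonneg b]

/-- At an optimal control the first variation vanishes, so the cost gap is the quadratic part.
Together with `IsState.seminormSq_le` it dominates the error norm, and the residual majorant
contributes a nonnegative amount. -/
theorem IsOptimal.cost_sub_eq (hT : 0 < T) {σ ν : Sp d → ℝ} {Cσ Cν : ℝ}
    (hσm : AEStronglyMeasurable σ (volume.restrict Ω))
    (hνm : AEStronglyMeasurable ν (volume.restrict Ω))
    (hσ : ∀ᵐ x ∂(volume.restrict Ω), ‖σ x‖ ≤ Cσ) (hν : ∀ᵐ x ∂(volume.restrict Ω), ‖ν x‖ ≤ Cν)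
    {lam : ℝ} {yd u yu v yv : Sp d × ℝ → ℝ} {Gu Gv : Sp d × ℝ → Sp d}
    (hyd : MemLp yd 2 (volQ Ω T)) (hu : IsOptimal Ω T σ ν lam yd u yu Gu)
    (hv : MemLp v 2 (volQ Ω T)) (hyv : IsState Ω T σ ν v yv Gv) :
    cost Ω T lam yd yv v - cost Ω T lam yd yu u
      = 1 / 2 * ∫ z, (yu z - yv z) ^ 2 ∂(volQ Ω T)
        + lam / 2 * ∫ z, (u z - v z) ^ 2 ∂(volQ Ω T) := by
  obtain ⟨hu2, hyu, hopt⟩ := hu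
  have hseg : ∀ θ : ℝ, cost Ω T lam yd (fun z => (1 - θ) * yu z + θ * yv z)
      (fun z => (1 - θ) * u z + θ * v z) = cost Ω T lam yd yu u
      + θ * (∫ z, (yu z - yd z) * (yv z - yu z) ∂(volQ Ω T)
        + lam * ∫ z, u z * (v z - u z) ∂(volQ Ω T))
      + θ ^ 2 * (1 / 2 * ∫ z, (yu z - yv z) ^ 2 ∂(volQ Ω T)
        + lam / 2 * ∫ z, (u z - v z) ^ 2 ∂(volQ Ω T)) := by
    intro θ
    have h1 := integral_sq_segment hyu.1.1.1 hyv.1.1.1 hyd θ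
    have h2 := integral_sq_segment hu2 hv (MemLp.zero' (p := 2) (μ := volQ Ω T)) θ
    simp only [sub_zero] at h2
    rw [cost, cost, h1, h2]
    ring
  -- Controls are unconstrained, so every real θ is admissible, not only those in [0,1]; the first
  -- variation therefore vanishes instead of being merely nonnegative.
  have hB := eq_zero_of_quadratic_nonneg fun θ => by
    have h1 := hopt _ _ _ ((hu2.const_mul (1 - θ)).add (hv.const_mul θ))
      (hyu.linearCombination hT hσm hνm hσ hν hu2 hv hyv (1 - θ) θ)
    have h2 := h1.trans_eq (hseg θ)
    rw [add_assoc] at h2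
    exact le_add_iff_nonneg_right _ |>.1 h2
  -- At θ = 1 the line reaches `v`, and only the quadratic part of the increment remains.
  have h1 := hseg 1
  rw [hB] at h1
  simp only [sub_self, zero_mul, one_mul, zero_add] at h1
  rw [h1]
  ring

end Cost
-- The error bound
/-- The right-hand side is an extended real number because the divergence of `τ ∈ H(div,Q)`, and
hence the norm of the residual `R₁`, need not be square integrable over `Q`. -/
theorem mainTheorem6 {d : ℕ} (Ω : Set (Sp d)) (hΩ : IsOpen Ω) (hΩb : Bornology.IsBounded Ω)
    (T : ℝ) (hT : 0 < T)
    (σ ν : Sp d → ℝ) (σlow σup νlow νup : ℝ)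
    (hσm : AEStronglyMeasurable σ (volume.restrict Ω))
    (hνm : AEStronglyMeasurable ν (volume.restrict Ω))
    (hσlow : 0 < σlow) (hνlow : 0 < νlow)
    (hσ : ∀ᵐ x ∂(volume.restrict Ω), σlow ≤ σ x ∧ σ x ≤ σup)
    (hν : ∀ᵐ x ∂(volume.restrict Ω), νlow ≤ ν x ∧ ν x ≤ νup)
    (CF : ℝ) (hCF : IsFriedrichsConst Ω CF)
    (lam : ℝ) (hlam : 0 < lam)
    (yd : Sp d × ℝ → ℝ) (hyd : MemLp yd 2 (volQ Ω T))
    (u yu : Sp d × ℝ → ℝ) (Gu : Sp d × ℝ → Sp d)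
    (hu : IsOptimal Ω T σ ν lam yd u yu Gu)
    (v yv : Sp d × ℝ → ℝ) (Gv : Sp d × ℝ → Sp d)
    (hv : MemLp v 2 (volQ Ω T)) (hyv : IsState Ω T σ ν v yv Gv)
    (η : Sp d × ℝ → ℝ) (Gη : Sp d × ℝ → Sp d) (dη : Sp d × ℝ → ℝ)
    (hη : IsH11ZeroPer Ω T η Gη dη)
    (τ : Sp d × ℝ → Sp d) (divτ : Sp d × ℝ → ℝ) (hτ : IsHDiv Ω T τ divτ) :
    ((errorNormSq Ω T lam (muOne νlow σlow) CF yu yv Gu Gv : ℝ) : EReal) ≤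
      ((cost Ω T lam yd yv v - cost Ω T lam yd yu u : ℝ) : EReal) +
      ((ENNReal.ofReal (3 * lam / (4 * CF ^ 2)) *
        (ENNReal.ofReal CF * eLpNorm (residual₁ σ dη divτ v) 2 (volQ Ω T) +
          eLpNorm (residual₂ ν Gη τ) 2 (volQ Ω T)) ^ 2 : ℝ≥0∞) : EReal) := by
  have hσb : ∀ᵐ x ∂(volume.restrict Ω), ‖σ x‖ ≤ σup := hσ.mono fun x hx => by
    rw [Real.norm_of_nonneg (hσlow.le.trans hx.1)]
    exact hx.2
  have hνb : ∀ᵐ x ∂(volume.restrict Ω), ‖ν x‖ ≤ νup := hν.mono fun x hx => by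
    rw [Real.norm_of_nonneg (hνlow.le.trans hx.1)]
    exact hx.2
  -- The difference of the states is a state for the control u - v, to which stability applies.
  have hdiff := hu.2.1.linearCombination hT hσm hνm hσb hνb hu.1 hv hyv 1 (-1)
  simp only [one_mul, neg_mul, one_smul, neg_smul, ← sub_eq_add_neg] at hdiff
  have hstab := hdiff.seminormSq_le hT hσm hνm hσb hνb hσlow hνlow (hσ.mono fun _ h => h.1)
    (hν.mono fun _ h => h.1) hCF (hu.1.sub hv)
  have hCF0 := hCF.1
  have hmain : errorNormSq Ω T lam (muOne νlow σlow) CF yu yv Gu Gv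
      ≤ cost Ω T lam yd yv v - cost Ω T lam yd yu u := by
    -- Both sides now contain ½‖y(u)-y(v)‖²; what remains is stability multiplied by λ/(2C_F²).
    rw [hu.cost_sub_eq hT hσm hνm hσb hνb hyd hv hyv, errorNormSq]
    refine add_le_add_right ?_ _
    calc _ = lam / (2 * CF ^ 2) * (muOne νlow σlow ^ 2 *
          seminormSq Ω T (fun z => yu z - yv z) (fun z => Gu z - Gv z)) := by ring
      _ ≤ lam / (2 * CF ^ 2) * (CF ^ 2 * ∫ z, (u z - v z) ^ 2 ∂(volQ Ω T)) :=
          mul_le_mul_of_nonneg_left hstab (by positivity)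
      _ = _ := by field_simp
  exact le_add_of_le_of_nonneg (EReal.coe_le_coe_iff.2 hmain) (EReal.coe_ennreal_nonneg _)
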